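/- Let $k\ge 3$ and let $K_k=\bigwedge_{1\le i<j\le k}S_{i,j}(x_i,x_j)$ be the clique query: given $\binom k2$ binary relations $S_{i,j}\subseteq[n]^2$, its output is the set of all $(a_1,\dots,a_k)\in[n]^k$ such that $(a_i,a_j)\in S_{i,j}$ for all $i<j$. All relations have the same number $m$ of tuples, hence the same size $M=2m\log_2 n$ in bits. The model (MPC). There are $p\ge 1$ servers, and the tuples of the input are initially partitioned among them uniformly but otherwise arbitrarily (each server stores at most $\lceil \binom k2 m/p\rceil$ tuples). All servers know $p$, $n$, $m$, the heavy hitters of the input with their frequencies (for each relation and each of its two positions, the values that occur at that position in at least $m/p$ tuples), and a common random seed, uniformly distributed in a finite set and independent of the input. In each round every server sends to every server a bit string that depends only on this common knowledge, on its initial data and on everything it has received in earlier rounds; local computation is unrestricted. After the last round each server outputs a set of tuples. The load of an execution is the maximum number of bits that any server receives during any round. Claim. There are randomized MPC algorithms $A_{p,n,m}$ (for all $p$, $n$, $m$) that compute $K_k$ in $k-1$ rounds with load $\tilde O(M/p^{2/k})$ with high probability, where $\tilde O$ hides a polylogarithmic factor in $p$. Precisely: (i) for every such input with any uniform placement, and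 every seed, the union of the outputs of the servers after $k-1$ rounds is exactly the output of $K_k$; (ii) there is a $d$ (depending only on $k$) such that for every $c\in\mathbb N$ there is a constant $C$ (depending only on $k$ and $c$) such that for all $p\ge 1$, $n$ and $m$ with $m\ge p^{2/k}$, every such input and every uniform placement, with probability at least $1-p^{-c}$ over the seed the load of these $k-1$ rounds is at most $$C\,(1+\ln p)^d\,\frac{M}{p^{2/k}} .$$ -/

import Mathlib

/-! ### Full conjunctive queries without self-joins -/

/-- A full conjunctive query without self-joins in the variables `x_i`, `i : Fin k`. Each element
`j : Atom` is an atom with its own relation symbol, of arity `arity j`; the variable at position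
`a` of the atom is `attr j a`. The query is full: all the variables belong to the head. -/
structure ConjQuery (k : ℕ) where
  Atom : Type
  [fintypeAtom : Fintype Atom]
  arity : Atom → ℕ
  attr : (j : Atom) → Fin (arity j) → Fin k

attribute [instance] ConjQuery.fintypeAtom

namespace ConjQuery

variable {k : ℕ} (q : ConjQuery k)

/-- A database over the domain `Fin n` (of size `n`): one finite relation for each atom. -/
abbrev Instance (n : ℕ) : Type :=
  (j : q.Atom) → Finset (Fin (q.arity j) → Fin n)

/-- The output of the query: all assignments of domain values to the variables whose projection
on each atom belongs to the relation of the atom. -/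
def answer {n : ℕ} (I : q.Instance n) : Set (Fin k → Fin n) :=
  {t | ∀ j, (fun a => t (q.attr j a)) ∈ I j}

/-- The frequency (degree) of the value `v` at position `a` of the relation of the atom `j`. -/
def freq {n : ℕ} (I : q.Instance n) (j : q.Atom) (a : Fin (q.arity j)) (v : Fin n) : ℕ :=
  ((I j).filter (fun t => t a = v)).card

/-- The data statistics about heavy hitters: for each position of each relation, the values `v`
that are heavy hitters (frequency at least `|S_j| / p`), together with their frequencies;
`none` means that `v` is not a heavy hitter. -/
def heavyHitters {n : ℕ} (p : ℕ) (I : q.Instance n) :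
    (j : q.Atom) → Fin (q.arity j) → Fin n → Option ℕ :=
  fun j a v => if (I j).card ≤ p * q.freq I j a v then some (q.freq I j a v) else none

/-- The type of the heavy-hitter statistics. -/
abbrev Stats (n : ℕ) : Type :=
  (j : q.Atom) → Fin (q.arity j) → Fin n → Option ℕ

/-- A placement of the tuples of the input on `p` servers. -/
abbrev Placement (n p : ℕ) : Type :=
  (j : q.Atom) → (Fin (q.arity j) → Fin n) → Fin p

/-- The part of the input that is initially stored at server `s`. The parts of the `p` servers
form a partition of the input. -/
def localPart {n p : ℕ} (I : q.Instance n) (π : q.Placement n p) (s : Fin p) : q.Instance n :=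
  fun j => (I j).filter (fun t => π j t = s)

/-- The input is uniformly partitioned: no server stores more than a `1 / p` fraction of the
tuples of the input (rounded up). -/
def IsUniform {n p : ℕ} (I : q.Instance n) (π : q.Placement n p) : Prop :=
  ∀ s, ∑ j, (q.localPart I π s j).card ≤ ⌈((∑ j, (I j).card : ℕ) : ℝ) / p⌉₊

/-- The clique query `K_k = ⋀_{i < j} S_{i,j}(x_i, x_j)`. -/
abbrev clique (k : ℕ) : ConjQuery k where
  Atom := {e : Fin k × Fin k // e.1 < e.2}
  arity := fun _ => 2
  attr := fun e => ![e.1.1, e.1.2]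

end ConjQuery

/-! ### The Massively Parallel Computation model -/

/-- A (randomized) MPC algorithm with `p` servers. The servers share a seed that is uniformly
distributed in the finite set `Seed` (used for choosing hash functions), and they all know the
statistics `stat : Stat`. At any time a server has its local part of the input and the history of
the messages that it has received: a list with one entry for each round so far, the latest first,
where an entry gives for each sender a string of bits. In the next round it sends to each server a
string of bits (`send s stat ω x h s'` is sent by `s` to `s'`), and after the last round it
outputs a finite set (`output s stat ω x h`). Local computation is unrestricted. -/
structure MPCAlgorithm (Input Stat Out : Type) (p : ℕ) where
  Seed : Type
  [finiteSeed : Finite Seed]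
  [nonemptySeed : Nonempty Seed]
  send : Fin p → Stat → Seed → Input → List (Fin p → List Bool) → Fin p → List Bool
  output : Fin p → Stat → Seed → Input → List (Fin p → List Bool) → Finset Out

namespace MPCAlgorithm

variable {Input Stat Out : Type} {p : ℕ} (A : MPCAlgorithm Input Stat Out p)

/-- The history of server `s` after `r` rounds, if server `s'` initially stores `x s'`. -/
def history (stat : Stat) (ω : A.Seed) (x : Fin p → Input) :
    ℕ → Fin p → List (Fin p → List Bool)
  | 0, _ => []
  | r + 1, s =>
      (fun s' => A.send s' stat ω (x s') (history stat ω x r s') s) :: history stat ω x r s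

/-- The number of bits that server `s` receives during round `r + 1`. -/
def received (stat : Stat) (ω : A.Seed) (x : Fin p → Input) (r : ℕ) (s : Fin p) : ℕ :=
  ∑ s', (A.send s' stat ω (x s') (A.history stat ω x r s') s).length

/-- The maximum load in an execution with `r` rounds: the maximum number of bits received by
any server during any round. -/
def maxLoad (stat : Stat) (ω : A.Seed) (x : Fin p → Input) (r : ℕ) : ℕ :=
  (Finset.range r ×ˢ Finset.univ).sup (fun y => A.received stat ω x y.1 y.2)

/-- The union of the outputs of the servers after `r` rounds. -/
def result (stat : Stat) (ω : A.Seed) (x : Fin p → Input) (r : ℕ) : Set Out :=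
  {t | ∃ s, t ∈ A.output s stat ω (x s) (A.history stat ω x r s)}

/-- The probability of an event, over the uniformly random seed. -/
noncomputable def prob (E : A.Seed → Prop) : ℝ :=
  (Nat.card {ω : A.Seed // E ω} : ℝ) / Nat.card A.Seed

end MPCAlgorithm

/-- MPC algorithms with `p` servers for a conjunctive query `q` over the domain `Fin n`, with the
heavy-hitter statistics available. -/
abbrev ConjQuery.Algorithm {k : ℕ} (q : ConjQuery k) (n p : ℕ) : Type 1 :=
  MPCAlgorithm (q.Instance n) (q.Stats n) (Fin k → Fin n) p

/-- The size in bits `M = 2 m log n` of a binary relation with `m` tuples over a domain of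
size `n`. -/
noncomputable def binaryRelationBits (m n : ℕ) : ℝ := 2 * m * Real.logb 2 n

/-! ### Uniform probability on finite types -/

namespace CliqueMPC

open Finset

/-! View the input as a `k`-partite graph on pairs (variable, value). Put `l = p ^ (1 / k)`, `Λ =
⌈l⌉` and `W = m / l ^ 2`, the target number of edges per server. A vertex is heavy if it has more
than `m / Λ` neighbours in some variable, so each variable has at most `k Λ` heavy values. A tuple
belongs to the cell given by its heavy values and by the buckets of a random hash of its light
values. With `Λ` buckets per light variable there are `O(Λ ^ k) = O(p)` cells, hence `O(1)` per
server, and a cell has about `m / Λ ^ 2` edges between two light variables; these counts concentrate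
because light degrees are at most `l W`.

The edges from a heavy `x` to light vertices are the obstacle: there may be `m` of them, and hashing
one endpoint into `Λ` buckets gains only a factor `Λ`. If the pattern has a single light variable,
there is room for about `deg / W` buckets, where `deg` is the largest degree of a prescribed value
into that variable; as degrees sum to at most `m`, the number of cells stays `O(Λ ^ k)`. If there
are two light variables, the edge `(x, y)` matters only if `y` has an edge to a light `z` of the
cell. So a preceding round computes these semijoins, and each surviving edge is charged to a light
edge of the cell. In the semijoin round a light edge `(y, z)` is copied for every heavy `x`, which
makes `O(l ^ 3 W) = O(p W)` copies in all, since `k ≥ 3`. The neighbourhood of `y` is cut into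
chunks of about `W` edges, `(x, y)` is copied for each chunk, and a random function `G` spreads the
triples of `x`, `y` and chunk over the servers. Thus two rounds do the work.

Randomness affects only destinations, so the output is right for every seed (`exists_mem_cliques`).
The load rests on the Chernoff bound `pr_weight_le`, the union bound `Regular.pr_not_good`, the
count `Regular.card_cells_le` and the charging in `Regular.final_load_le`; `regular_layout` shows
that the heavy-hitter statistics suffice. -/

open Classical in
/-- The probability of an event under the uniform distribution on a finite type. -/
noncomputable def pr {Ω : Type*} [Fintype Ω] (B : Ω → Prop) : ℝ :=
  ((univ.filter B).card : ℝ) / Fintype.card Ω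

section pr

variable {Ω Ω' : Type*} [Fintype Ω] [Fintype Ω']

theorem pr_def (B : Ω → Prop) [DecidablePred B] :
    pr B = ((univ.filter B).card : ℝ) / Fintype.card Ω := by
  unfold pr
  congr

theorem pr_mono {B B' : Ω → Prop} (h : ∀ ω, B ω → B' ω) : pr B ≤ pr B' := by
  classical
  simp only [pr_def]
  gcongr with ω
  exact h ω

theorem pr_or_le (B B' : Ω → Prop) : pr (fun ω => B ω ∨ B' ω) ≤ pr B + pr B' := by
  classical
  rw [pr_def, pr_def, pr_def, ← add_div, filter_or]
  gcongr
  exact_mod_cast card_union_le _ _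

theorem pr_exists_le {ι : Type*} (s : Finset ι) (B : ι → Ω → Prop) {ε : ℝ}
    (h : ∀ i ∈ s, pr (B i) ≤ ε) : pr (fun ω => ∃ i ∈ s, B i ω) ≤ s.card * ε := by
  classical
  calc pr (fun ω => ∃ i ∈ s, B i ω) ≤ ∑ i ∈ s, pr (B i) := by
        simp only [pr_def]
        rw [← sum_div]
        gcongr
        have : univ.filter (fun ω => ∃ i ∈ s, B i ω) = s.biUnion fun i => univ.filter (B i) := by
          ext ω; simp
        rw [this]
        exact_mod_cast card_biUnion_le
    _ ≤ s.card * ε := by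
        rw [← nsmul_eq_mul]
        exact sum_le_card_nsmul _ _ _ h

theorem pr_not [Nonempty Ω] (B : Ω → Prop) : pr (fun ω => ¬ B ω) = 1 - pr B := by
  classical
  rw [pr_def, pr_def]
  have h : (Fintype.card Ω : ℝ) ≠ 0 := by exact_mod_cast Fintype.card_ne_zero
  rw [eq_sub_iff_add_eq, ← add_div, div_eq_one_iff_eq h]
  have := card_filter_add_card_filter_not (s := (univ : Finset Ω)) B
  rw [card_univ] at this
  rw [← this]
  push_cast
  ring

/-- Fubini: bound the conditional probability given the first component. It lets the hash functions
be fixed before the routing function is drawn. -/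
theorem pr_prod_le {B : Ω × Ω' → Prop} {ε : ℝ} (h : ∀ a, pr (fun b => B (a, b)) ≤ ε)
    (hε : 0 ≤ ε) : pr B ≤ ε := by
  classical
  simp only [pr_def] at *
  rcases isEmpty_or_nonempty Ω' with h' | h'
  · simpa using hε
  rcases isEmpty_or_nonempty Ω with h'' | h''
  · simpa using hε
  have h1 : (0 : ℝ) < Fintype.card Ω := by exact_mod_cast Fintype.card_pos
  have h2 : (0 : ℝ) < Fintype.card Ω' := by exact_mod_cast Fintype.card_pos
  simp_rw [div_le_iff₀ h2] at h
  have e : (univ.filter B).card = ∑ a, (univ.filter fun b => B (a, b)).card := by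
    simp only [card_filter, ← univ_product_univ, sum_product]
  rw [Fintype.card_prod, Nat.cast_mul, div_le_iff₀ (by positivity), e]
  push_cast
  calc _ ≤ ∑ a : Ω, ε * (Fintype.card Ω' : ℝ) := sum_le_sum fun a _ => h a
    _ = _ := by simp; ring

theorem pr_fst_le {B : Ω → Prop} {ε : ℝ} (h : pr B ≤ ε) :
    pr (fun ω : Ω × Ω' => B ω.1) ≤ ε := by
  classical
  refine le_trans ?_ h
  simp only [pr_def]
  have e : (univ.filter fun ω : Ω × Ω' => B ω.1) = (univ.filter B) ×ˢ univ := by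
    ext; simp
  rcases isEmpty_or_nonempty Ω' with h' | h'
  · simp; positivity
  have h2 : (Fintype.card Ω' : ℝ) ≠ 0 := by exact_mod_cast Fintype.card_ne_zero
  rw [e, card_product, Fintype.card_prod, card_univ]
  push_cast
  rw [mul_div_mul_right _ _ h2]

/-- Resampling one coordinate of a random vector. -/
theorem pr_update_le {ι : Type*} [Fintype ι] [DecidableEq ι] (j : ι) {B : (ι → Ω) → Prop} {ε : ℝ}
    (hε : 0 ≤ ε) (h : ∀ u, pr (fun f => B (Function.update u j f)) ≤ ε) : pr B ≤ ε := by
  classical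
  -- `σ` exchanges coordinate `j` with the extra sample. It is an involution, so the resampled
  -- vector is again uniform.
  let σ : (ι → Ω) × Ω → (ι → Ω) × Ω := fun x => (Function.update x.1 j x.2, x.1 j)
  have hσ : Function.Involutive σ := by
    rintro ⟨u, f⟩
    simp [σ]
  have h1 := pr_prod_le (B := fun x : (ι → Ω) × Ω => B (Function.update x.1 j x.2)) h hε
  refine le_trans ?_ h1
  rcases isEmpty_or_nonempty Ω with h' | h'
  · unfold pr
    rw [Fintype.card_eq_zero_iff.2 ⟨fun u => h'.false (u j)⟩]
    simp
  have h2 : (Fintype.card Ω : ℝ) ≠ 0 := by exact_mod_cast Fintype.card_ne_zero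
  simp only [pr_def]
  have e : (univ.filter fun x : (ι → Ω) × Ω => B (Function.update x.1 j x.2)).card =
      ((univ.filter B) ×ˢ (univ : Finset Ω)).card := by
    refine card_bij (fun x _ => σ x) ?_ (fun a _ b _ hab => hσ.injective hab) ?_
    · intro x hx; simpa [σ] using hx
    · intro x hx
      refine ⟨σ x, ?_, hσ x⟩
      have : σ (σ x) = x := hσ x
      have h3 : Function.update (σ x).1 j (σ x).2 = x.1 := congrArg Prod.fst this
      simp only [mem_filter, mem_univ, true_and, h3]
      simpa using hx
  rw [e, card_product, Fintype.card_prod, card_univ]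
  push_cast
  rw [mul_div_mul_right _ _ h2]

/-- Chernoff bound for weighted hashing: each `x` is hashed to a uniform and independent value,
which lies in `A x` with probability at most `q`. -/
theorem pr_weight_le {X Y : Type*} [Fintype X] [DecidableEq X] [Fintype Y] [Nonempty Y]
    (A : X → Y → Prop) [∀ x, DecidablePred (A x)] (w : X → ℝ) {W q μ t : ℝ} (hW : 0 < W)
    (hw0 : ∀ x, 0 ≤ w x) (hwW : ∀ x, w x ≤ W)
    (hq : ∀ x, ((univ.filter (A x)).card : ℝ) ≤ q * Fintype.card Y)
    (hμ : q * ∑ x, w x ≤ μ * W) :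
    pr (fun f : X → Y => t * W < ∑ x, if A x (f x) then w x else 0) ≤ Real.exp (2 * μ - t) := by
  classical
  have hY : (0 : ℝ) < Fintype.card Y := by exact_mod_cast Fintype.card_pos
  have hF : (0 : ℝ) < Fintype.card (X → Y) := by exact_mod_cast Fintype.card_pos
  simp only [pr_def]
  rw [div_le_iff₀ hF]
  let g : X → Y → ℝ := fun x y => Real.exp (if A x y then w x / W else 0)
  have h1 : ((univ.filter fun f : X → Y => t * W < ∑ x, if A x (f x) then w x else 0).card : ℝ)
      ≤ ∑ f : X → Y, Real.exp (-t) * ∏ x, g x (f x) := by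
    rw [card_filter]
    push_cast
    refine sum_le_sum fun f _ => ?_
    split_ifs with hf
    · rw [← Real.exp_sum, ← Real.exp_add]
      refine Real.one_le_exp ?_
      have : ∑ x, (if A x (f x) then w x / W else 0) = (∑ x, if A x (f x) then w x else 0) / W := by
        rw [sum_div]
        exact sum_congr rfl fun x _ => by split_ifs <;> simp
      rw [this]
      have := (lt_div_iff₀ hW).2 hf
      linarith
    · have : 0 ≤ ∏ x, g x (f x) := prod_nonneg fun x _ => (Real.exp_pos _).le
      positivity
  have h2 : ∀ x, ∑ y, g x y ≤ Fintype.card Y * Real.exp (2 * q * w x / W) := by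
    intro x
    have hv0 : 0 ≤ w x / W := div_nonneg (hw0 x) hW.le
    have hv1 : w x / W ≤ 1 := (div_le_one hW).2 (hwW x)
    have hexp : Real.exp (w x / W) - 1 ≤ 2 * (w x / W) := by
      have := Real.abs_exp_sub_one_le (x := w x / W) (by rwa [abs_of_nonneg hv0])
      rw [abs_of_nonneg hv0] at this
      exact (le_abs_self _).trans this
    have e : ∑ y, g x y = Fintype.card Y +
        (univ.filter (A x)).card * (Real.exp (w x / W) - 1) := by
      have : ∀ y, g x y = 1 + if A x y then Real.exp (w x / W) - 1 else 0 := by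
        intro y; simp only [g]; split_ifs <;> simp
      simp_rw [this, sum_add_distrib, ← sum_filter, sum_const, nsmul_eq_mul]
      simp
    have h0 : 0 ≤ Real.exp (w x / W) - 1 := by
      have := Real.one_le_exp hv0
      linarith
    have hq' := hq x
    have hcard : 0 ≤ ((univ.filter (A x)).card : ℝ) := by positivity
    rw [e]
    calc _ ≤ Fintype.card Y + q * Fintype.card Y * (2 * (w x / W)) := by gcongr; linarith
      _ = Fintype.card Y * (2 * q * w x / W + 1) := by ring
      _ ≤ _ := by gcongr; exact Real.add_one_le_exp _
  calc _ ≤ _ := h1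
    _ = Real.exp (-t) * ∏ x, ∑ y, g x y := by
        rw [← mul_sum, prod_univ_sum, Fintype.piFinset_univ]
    _ ≤ Real.exp (-t) * ∏ x, (Fintype.card Y * Real.exp (2 * q * w x / W)) := by
        refine mul_le_mul_of_nonneg_left (prod_le_prod (fun x _ => ?_) fun x _ => h2 x)
          (Real.exp_pos _).le
        exact sum_nonneg fun y _ => (Real.exp_pos _).le
    _ = Real.exp (2 * (q * ∑ x, w x) / W - t) * Fintype.card (X → Y) := by
        rw [prod_mul_distrib, ← Real.exp_sum, ← sum_div, ← mul_sum, sub_eq_add_neg, Real.exp_add,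
          Fintype.card_fun]
        simp
        ring_nf
    _ ≤ _ := by
        gcongr
        rw [div_le_iff₀ hW]
        linarith

end pr

/-- At most a fraction `2 / c` of the elements of `Fin N` have a given residue modulo `c`. -/
theorem card_mod_eq_le {N c : ℕ} (hc : 1 ≤ c) (hcN : c ≤ N) (r : ℕ) :
    ((univ.filter fun y : Fin N => (y : ℕ) % c = r).card : ℝ) ≤ 2 / c * Fintype.card (Fin N) := by
  have h1 : (univ.filter fun y : Fin N => (y : ℕ) % c = r).card ≤ N / c + 1 := by
    rw [← card_range (N / c + 1)]
    refine card_le_card_of_injOn (fun y => (y : ℕ) / c) ?_ ?_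
    · intro y _
      simp only [coe_range, Set.mem_Iio]
      exact Nat.lt_succ_of_le (Nat.div_le_div_right y.2.le)
    · intro a ha b hb hab
      simp only [coe_filter, mem_univ, true_and, Set.mem_ofPred_eq] at ha hb hab
      ext
      rw [← Nat.div_add_mod a c, ← Nat.div_add_mod b c, ha, hb, hab]
  have hc' : (0 : ℝ) < c := by exact_mod_cast hc
  have h2 : ((N / c : ℕ) : ℝ) ≤ N / c := Nat.cast_div_le
  -- As `c ≤ N`, the `+ 1` from rounding costs at most a factor `2`. So one hash function serves all
  -- moduli up to `N`.
  have h3 : (1 : ℝ) ≤ N / c := by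
    rw [le_div_iff₀ hc']; simpa using (by exact_mod_cast hcN : (c : ℝ) ≤ N)
  have h4 : ((univ.filter fun y : Fin N => (y : ℕ) % c = r).card : ℝ) ≤ (N / c : ℕ) + 1 := by
    exact_mod_cast h1
  rw [Fintype.card_fin]
  calc _ ≤ _ := h4
    _ ≤ (N / c + N / c : ℝ) := by gcongr
    _ = _ := by ring

end CliqueMPC

/-! ### The algorithm -/

namespace CliqueMPC

open Finset

/-! ### Encoding of finite sets by bits, and even distribution -/

/-- Code words of equal length can be split off one by one; positive length is needed to recognise
the empty list. -/
theorem flatMap_injective_of_length {F : Type*} {ℓ : ℕ} (hℓ : 0 < ℓ) {c : F → List Bool}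
    (hc : Function.Injective c) (hlen : ∀ x, (c x).length = ℓ) :
    Function.Injective fun l : List F => l.flatMap c := by
  intro l₁
  induction l₁ with
  | nil =>
    rintro (_ | ⟨b, l₂⟩) h
    · rfl
    · have := congrArg List.length h
      simp [hlen] at this
      omega
  | cons a l₁ ih =>
    rintro (_ | ⟨b, l₂⟩) h
    · have := congrArg List.length h
      simp [hlen] at this
      omega
    · simp only [List.flatMap_cons] at h
      obtain ⟨h1, h2⟩ := List.append_inj h ((hlen a).trans (hlen b).symm)
      rw [hc h1, ih h2]

/-- Finite sets of elements of a finite type `F` can be encoded by bit strings, with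
`⌈log₂ |F|⌉ + 1` bits for each element. -/
theorem exists_encoding (F : Type*) [Fintype F] : ∃ enc : Finset F → List Bool,
    Function.Injective enc ∧
      ∀ S, (enc S).length = S.card * (Nat.clog 2 (Fintype.card F) + 1) := by
  classical
  -- The `+ 1` keeps the length positive when `F` has at most one element.
  set ℓ := Nat.clog 2 (Fintype.card F) + 1
  obtain ⟨c⟩ : Nonempty (F ↪ (Fin ℓ → Bool)) := by
    refine Function.Embedding.nonempty_of_card_le ?_
    simp only [Fintype.card_fun, Fintype.card_bool, Fintype.card_fin]
    exact (Nat.le_pow_clog one_lt_two _).trans (Nat.pow_le_pow_right two_pos (Nat.le_succ _))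
  refine ⟨fun S => S.toList.flatMap fun x => List.ofFn (c x), ?_, fun S => ?_⟩
  · intro S T h
    have h1 := flatMap_injective_of_length (ℓ := ℓ) (Nat.succ_pos _)
      (c := fun x => List.ofFn (c x)) (fun x y h => c.injective (List.ofFn_injective h))
      (fun x => by simp [ℓ]) h
    rw [← S.toList_toFinset, h1, T.toList_toFinset]
  · simp [List.length_flatMap, ℓ]

/-- Every finite set can be distributed evenly among `p` servers. -/
theorem exists_balanced {α : Type*} (F : Finset α) (p : ℕ) [NeZero p] :
    ∃ f : α → Fin p, ∀ s, (F.filter fun x => f x = s).card ≤ F.card / p + 1 := by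
  classical
  refine ⟨fun x => if h : x ∈ F then
    ⟨F.equivFin ⟨x, h⟩ % p, Nat.mod_lt _ (NeZero.pos p)⟩ else 0, fun s => ?_⟩
  rw [← card_range (F.card / p + 1)]
  refine card_le_card_of_injOn
    (fun x => if h : x ∈ F then (F.equivFin ⟨x, h⟩ : ℕ) / p else 0) ?_ ?_
  · intro x hx
    have hx' : x ∈ F := (mem_filter.1 hx).1
    simp only [hx', dite_true, coe_range, Set.mem_Iio]
    exact Nat.lt_succ_of_le (Nat.div_le_div_right (F.equivFin ⟨x, hx'⟩).2.le)
  · intro x hx y hy hxy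
    obtain ⟨hx', hxs⟩ := mem_filter.1 hx
    obtain ⟨hy', hys⟩ := mem_filter.1 hy
    simp only [hx', hy', dite_true] at hxs hys hxy
    have h : (F.equivFin ⟨x, hx'⟩ : ℕ) % p = (F.equivFin ⟨y, hy'⟩ : ℕ) % p := by
      rw [← hys] at hxs
      exact congrArg Fin.val hxs
    have h2 : (F.equivFin ⟨x, hx'⟩ : ℕ) = F.equivFin ⟨y, hy'⟩ := by
      rw [← Nat.div_add_mod (F.equivFin ⟨x, hx'⟩ : ℕ) p, h, hxy, Nat.div_add_mod]
    simpa using F.equivFin.injective (Fin.ext h2)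

/-- The even distribution of a finite set among `p` servers. -/
noncomputable def balanced {α : Type*} (F : Finset α) (p : ℕ) [NeZero p] : α → Fin p :=
  (exists_balanced F p).choose

theorem card_balanced_le {α : Type*} [DecidableEq α] (F : Finset α) (p : ℕ) [NeZero p]
    (s : Fin p) : (F.filter fun x => balanced F p x = s).card ≤ F.card / p + 1 :=
  (exists_balanced F p).choose_spec s

/-! ### The `k`-partite graph, the cells and the messages -/

/-- The pair `(i, a)` stands for the value `a` of the variable `x_i`. The input of the clique query
is viewed as a `k`-partite graph on these pairs. -/
abbrev Vertex (k n : ℕ) : Type := Fin k × Fin n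

/-- An oriented edge of the `k`-partite graph. -/
abbrev Edge (k n : ℕ) : Type := Vertex k n × Vertex k n

variable {k n p N : ℕ}

/-- Adjacency in the `k`-partite graph of an input. -/
def Adj (I : (ConjQuery.clique k).Instance n) (x y : Vertex k n) : Prop :=
  if h : x.1 < y.1 then (![x.2, y.2] : Fin 2 → Fin n) ∈ I ⟨(x.1, y.1), h⟩
  else if h : y.1 < x.1 then (![y.2, x.2] : Fin 2 → Fin n) ∈ I ⟨(y.1, x.1), h⟩
  else False

open Classical in
/-- The oriented edges of the `k`-partite graph of an input. -/
noncomputable def edges (I : (ConjQuery.clique k).Instance n) : Finset (Edge k n) :=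
  univ.filter fun e => Adj I e.1 e.2

/-- The data that the servers derive from the statistics: the number `side` of buckets for the
light values of a variable, the set of heavy vertices, and the number of chunks into which the
edges from a vertex to the values of a variable are split. -/
structure Layout (k n : ℕ) where
  side : ℕ
  heavy : Vertex k n → Prop
  chunks : Vertex k n → Fin k → ℕ

/-- A cell consists of a pattern, which prescribes the heavy values of some variables and declares
the other variables light, and of buckets for the light variables. -/
abbrev Cell (k n : ℕ) : Type := Σ _ : Fin k → Option (Fin n), Fin k → ℕ

/-- The light variables of a pattern. -/
def lights (η : Fin k → Option (Fin n)) : Finset (Fin k) := univ.filter fun i => η i = none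

namespace Layout

variable (P : Layout k n)

/-- The number of buckets of the light variables of a pattern. -/
def share (η : Fin k → Option (Fin n)) : ℕ :=
  -- With one light variable, the maximum makes the buckets fine enough to cut the neighbourhood of
  -- every prescribed heavy value into pieces of about `W` edges.
  if 2 ≤ (lights η).card then P.side
  else (univ ×ˢ lights η).sup fun x => (η x.1).elim 0 fun v => P.chunks (x.1, v) x.2

open Classical in
/-- The patterns whose prescribed values are heavy. -/
noncomputable def patterns : Finset (Fin k → Option (Fin n)) :=
  univ.filter fun η => ∀ i v, η i = some v → P.heavy (i, v)

/-- The cells used by the algorithm. -/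
noncomputable def cells : Finset (Cell k n) :=
  P.patterns.sigma fun η =>
    Fintype.piFinset fun i => range (if η i = none then P.share η else 1)

/-- The server that is responsible for a cell. -/
noncomputable def place (p : ℕ) [NeZero p] : Cell k n → Fin p := balanced P.cells p

variable (u : Fin k → Fin n → Fin N)

/-- The vertex `x` belongs to the cell `β`. -/
def Fits (β : Cell k n) (x : Vertex k n) : Prop :=
  (P.heavy x ∧ β.1 x.1 = some x.2) ∨
    (¬ P.heavy x ∧ β.1 x.1 = none ∧ (u x.1 x.2 : ℕ) % P.share β.1 = β.2 x.1)

/-- The chunk of the edge from `y` to `z`. -/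
def chunk (y z : Vertex k n) : Fin N :=
  ⟨(u z.1 z.2 : ℕ) % P.chunks y z.1, (Nat.mod_le _ _).trans_lt (u z.1 z.2).2⟩

variable (G : Vertex k n × Vertex k n × Fin k × Fin N → Fin p)

/-- The edge from a heavy vertex `x` to a light vertex `y` is sent to the server `s` for the
semijoins with the edges at `y`. -/
def SendsHeavy (s : Fin p) (e : Edge k n) : Prop :=
  P.heavy e.1 ∧ ¬ P.heavy e.2 ∧
    ∃ (j : Fin k) (r : Fin N), (r : ℕ) < P.chunks e.2 j ∧ G (e.1, e.2, j, r) = s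

/-- The edge between light vertices is sent to the server `s` for the semijoin with the edges
between its first vertex and some heavy vertex. -/
def SendsLight (s : Fin p) (e : Edge k n) : Prop :=
  ¬ P.heavy e.1 ∧ ¬ P.heavy e.2 ∧ ∃ x, P.heavy x ∧ G (x, e.1, e.2.1, P.chunk u e.1 e.2) = s

open Classical in
/-- The edges sent to the server `s` for the semijoins. -/
noncomputable def semijoinMsg (D : Finset (Edge k n)) (s : Fin p) : Finset (Edge k n) :=
  D.filter fun e => P.SendsHeavy G s e ∨ P.SendsLight u G s e

variable [NeZero p]

/-- The edge is sent directly to the server `s`, which is responsible for a cell with this edge. -/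
def SendsDirect (s : Fin p) (e : Edge k n) : Prop :=
  ∃ β ∈ P.cells, P.place p β = s ∧ P.Fits u β e.1 ∧ P.Fits u β e.2 ∧
    ((P.heavy e.1 ↔ P.heavy e.2) ∨ (P.heavy e.1 ∧ ¬ P.heavy e.2 ∧ (lights β.1).card ≤ 1))

/-- The edge from a heavy vertex to a light vertex is sent from the server `s'` that computes a
semijoin to the server `s`. -/
def Relays (K : Finset (Edge k n)) (s' s : Fin p) (e : Edge k n) : Prop :=
  P.heavy e.1 ∧ ¬ P.heavy e.2 ∧ ∃ z, ¬ P.heavy z ∧ (e.2, z) ∈ K ∧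
    G (e.1, e.2, z.1, P.chunk u e.2 z) = s' ∧
    ∃ β ∈ P.cells, P.place p β = s ∧ 2 ≤ (lights β.1).card ∧
      P.Fits u β e.1 ∧ P.Fits u β e.2 ∧ P.Fits u β z

open Classical in
/-- The message from `s'` to `s` in the last round, if `s'` initially has the edges in `D` and has
received the edges in `K`. -/
noncomputable def finalMsg (D K : Finset (Edge k n)) (s' s : Fin p) : Finset (Edge k n) :=
  D.filter (P.SendsDirect u s) ∪ K.filter (P.Relays u G K s' s)

end Layout

open Classical in
/-- The cliques in a set of edges. -/
noncomputable def cliques (K : Finset (Edge k n)) : Finset (Fin k → Fin n) :=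
  univ.filter fun t => ∀ i j, i < j →
    ((i, t i), (j, t j)) ∈ K ∨ ((j, t j), (i, t i)) ∈ K

/-! ### Every clique is assembled at some server -/

theorem adj_comm (I : (ConjQuery.clique k).Instance n) (x y : Vertex k n) :
    Adj I x y ↔ Adj I y x := by
  unfold Adj
  rcases lt_trichotomy x.1 y.1 with h | h | h
  · simp [h, h.not_gt]
  · simp [h]
  · simp [h, h.not_gt]

theorem mem_answer_iff (I : (ConjQuery.clique k).Instance n) (t : Fin k → Fin n) :
    t ∈ (ConjQuery.clique k).answer I ↔ ∀ i j, i < j → ((i, t i), (j, t j)) ∈ edges I := by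
  have key : ∀ e : (ConjQuery.clique k).Atom,
      (fun a => t ((ConjQuery.clique k).attr e a)) = (![t e.1.1, t e.1.2] : Fin 2 → Fin n) := by
    intro e
    funext a
    change t ((![e.1.1, e.1.2] : Fin 2 → Fin k) a) = _
    fin_cases a <;> rfl
  constructor
  · intro h i j hij
    have := h ⟨(i, j), hij⟩
    rw [key] at this
    simpa [edges, Adj, hij] using this
  · rintro h ⟨⟨i, j⟩, hij⟩
    have := h i j hij
    rw [key]
    simpa [edges, Adj, show i < j from hij] using this

theorem edges_localPart_subset (I : (ConjQuery.clique k).Instance n)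
    (π : (ConjQuery.clique k).Placement n p) (s : Fin p) :
    edges ((ConjQuery.clique k).localPart I π s) ⊆ edges I := by
  intro e
  simp only [edges, Adj, ConjQuery.localPart, mem_filter, mem_univ, true_and]
  split_ifs <;> simp +contextual

theorem exists_mem_edges_localPart (I : (ConjQuery.clique k).Instance n)
    (π : (ConjQuery.clique k).Placement n p) {e : Edge k n} (he : e ∈ edges I) :
    ∃ s, e ∈ edges ((ConjQuery.clique k).localPart I π s) := by
  revert he
  simp only [edges, Adj, ConjQuery.localPart, mem_filter, mem_univ, true_and]
  split_ifs <;> simp +contextual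

/-- Since no edge is stored twice, sums over senders become counts in the whole graph. -/
theorem eq_of_mem_edges_localPart (I : (ConjQuery.clique k).Instance n)
    (π : (ConjQuery.clique k).Placement n p) {e : Edge k n} {s s' : Fin p}
    (h : e ∈ edges ((ConjQuery.clique k).localPart I π s))
    (h' : e ∈ edges ((ConjQuery.clique k).localPart I π s')) : s = s' := by
  revert h h'
  simp only [edges, Adj, ConjQuery.localPart, mem_filter, mem_univ, true_and]
  split_ifs
  · rintro ⟨-, h⟩ ⟨-, h'⟩; exact h.symm.trans h'
  · rintro ⟨-, h⟩ ⟨-, h'⟩; exact h.symm.trans h'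
  · exact fun h => h.elim

open Classical in
/-- The last round brings the edges of every clique together at some server. -/
theorem exists_mem_cliques (P : Layout k n) (u : Fin k → Fin n → Fin N) [NeZero p]
    (G : Vertex k n × Vertex k n × Fin k × Fin N → Fin p) {E : Finset (Edge k n)}
    {D K : Fin p → Finset (Edge k n)} {M : Fin p → Finset (Edge k n)} (hk : 2 ≤ k)
    (hside : 0 < P.side) (hchunks : ∀ x j, 0 < P.chunks x j)
    (hE : ∀ x y, (x, y) ∈ E → (y, x) ∈ E) (hD : ∀ e ∈ E, ∃ s, e ∈ D s)
    (hK : ∀ s s', P.semijoinMsg u G (D s') s ⊆ K s)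
    (hM : ∀ s s', P.finalMsg u G (D s') (K s') s' s ⊆ M s) {t : Fin k → Fin n}
    (ht : ∀ i j, i < j → ((i, t i), (j, t j)) ∈ E) : ∃ s, t ∈ cliques (M s) := by
  have ht' : ∀ i j, i ≠ j → ((i, t i), (j, t j)) ∈ E := by
    intro i j hij
    rcases hij.lt_or_gt with h | h
    · exact ht i j h
    · exact hE _ _ (ht j i h)
  -- `η` and `ρ` form the cell of `t`; the server of this cell will receive the whole clique.
  set η : Fin k → Option (Fin n) := fun i => if P.heavy (i, t i) then some (t i) else none with hη
  set ρ : Fin k → ℕ := fun i =>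
    if P.heavy (i, t i) then 0 else (u i (t i) : ℕ) % P.share η with hρ
  have hηnone : ∀ i, η i = none ↔ ¬ P.heavy (i, t i) := by intro i; simp [hη]
  have hfits : ∀ i, P.Fits u ⟨η, ρ⟩ (i, t i) := by
    intro i
    by_cases hi : P.heavy (i, t i)
    · exact Or.inl ⟨hi, by simp [hη, hi]⟩
    · exact Or.inr ⟨hi, by simp [hη, hi], by simp [hρ, hi]⟩
  have hshare : ∀ l, η l = none → 0 < P.share η := by
    intro l hl
    unfold Layout.share
    split_ifs with h2
    · exact hside
    -- If `l` is the only light variable, another variable exists as `k ≥ 2`; its heavy value makes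
    -- the maximum positive.
    · have : Nontrivial (Fin k) := Fin.nontrivial_iff_two_le.2 hk
      obtain ⟨i, hi⟩ := exists_ne l
      have hi' : η i ≠ none := fun h => h2 <| by
        refine one_lt_card.2 ⟨i, ?_, l, ?_, hi⟩ <;> simpa [lights]
      obtain ⟨v, hv⟩ := Option.ne_none_iff_exists'.1 hi'
      refine (hchunks (i, v) l).trans_le ?_
      have := le_sup (s := univ ×ˢ lights η)
        (f := fun x => (η x.1).elim 0 fun v => P.chunks (x.1, v) x.2) (b := (i, l))
        (by simp [lights, hl])
      simpa [hv] using this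
  have hcell : (⟨η, ρ⟩ : Cell k n) ∈ P.cells := by
    simp only [Layout.cells, mem_sigma, Fintype.mem_piFinset, mem_range]
    constructor
    · simp only [Layout.patterns, mem_filter, mem_univ, true_and]
      intro i v hv
      by_cases hi : P.heavy (i, t i)
      · have : t i = v := by simpa [hη, hi] using hv
        rwa [← this]
      · simp [hη, hi] at hv
    · intro i
      by_cases hi : η i = none
      · have hi' := (hηnone i).1 hi
        simp only [hi, hρ, hi', if_true, if_false]
        exact Nat.mod_lt _ (hshare i hi)
      · have hi' := not_not.1 (fun h => hi ((hηnone i).2 h))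
        simp [hi, hρ, hi']
  refine ⟨P.place p ⟨η, ρ⟩, ?_⟩
  have hsame : ∀ i j, i ≠ j → (P.heavy (i, t i) ↔ P.heavy (j, t j)) →
      ((i, t i), (j, t j)) ∈ M (P.place p ⟨η, ρ⟩) := by
    intro i j hij h
    obtain ⟨s', hs'⟩ := hD _ (ht' i j hij)
    refine hM _ s' (mem_union_left _ (mem_filter.2 ⟨hs', _, hcell, rfl, hfits i, hfits j, ?_⟩))
    exact Or.inl h
  have hmixed : ∀ i j, i ≠ j → P.heavy (i, t i) → ¬ P.heavy (j, t j) →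
      ((i, t i), (j, t j)) ∈ M (P.place p ⟨η, ρ⟩) := by
    intro i j hij hi hj
    obtain ⟨s₁, hs₁⟩ := hD _ (ht' i j hij)
    rcases Nat.lt_or_ge (lights η).card 2 with h2 | h2
    · refine hM _ s₁ (mem_union_left _ (mem_filter.2 ⟨hs₁, _, hcell, rfl, hfits i, hfits j, ?_⟩))
      exact Or.inr ⟨hi, hj, Nat.le_of_lt_succ h2⟩
    -- A second light variable `l` supplies the witness of the semijoin: the edges from `t j` to `t
    -- i` and to `t l` meet at `s'`.
    · obtain ⟨l, hl, hlj⟩ := exists_mem_ne h2 j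
      have hl' : ¬ P.heavy (l, t l) := by simpa [lights, hηnone] using hl
      obtain ⟨s₂, hs₂⟩ := hD _ (ht' j l hlj.symm)
      set s' := G ((i, t i), (j, t j), l, P.chunk u (j, t j) (l, t l)) with hs'
      have h₁ : ((i, t i), (j, t j)) ∈ K s' := by
        refine hK _ s₁ (mem_filter.2 ⟨hs₁, Or.inl ⟨hi, hj, l, _, ?_, rfl⟩⟩)
        exact Nat.mod_lt _ (hchunks _ _)
      have h₂ : ((j, t j), (l, t l)) ∈ K s' :=
        hK _ s₂ (mem_filter.2 ⟨hs₂, Or.inr ⟨hj, hl', (i, t i), hi, rfl⟩⟩)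
      exact hM _ s' (mem_union_right _ (mem_filter.2 ⟨h₁, hi, hj, (l, t l), hl', h₂, rfl, _,
        hcell, rfl, h2, hfits i, hfits j, hfits l⟩))
  simp only [cliques, mem_filter, mem_univ, true_and]
  intro i j hij
  by_cases hi : P.heavy (i, t i) <;> by_cases hj : P.heavy (j, t j)
  · exact Or.inl (hsame i j hij.ne (by tauto))
  · exact Or.inl (hmixed i j hij.ne hi hj)
  -- Mixed edges travel only in the orientation from heavy to light, which is why `cliques` accepts
  -- both orientations.
  · exact Or.inr (hmixed j i hij.ne' hj hi)
  · exact Or.inl (hsame i j hij.ne (by tauto))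

/-! ### The MPC algorithm and its execution -/

/-- The statistics in terms of the `k`-partite graph. -/
def degreeStat (stat : (ConjQuery.clique k).Stats n) (x : Vertex k n) (j : Fin k) : Option ℕ :=
  if h : x.1 < j then stat ⟨(x.1, j), h⟩ (0 : Fin 2) x.2
  else if h : j < x.1 then stat ⟨(j, x.1), h⟩ (1 : Fin 2) x.2
  else none

/-- The layout that is derived from the statistics. -/
def layout (Λ m : ℕ) (stat : (ConjQuery.clique k).Stats n) : Layout k n where
  side := Λ
  heavy x := ∃ j f, degreeStat stat x j = some f ∧ m < f * Λ
  -- The degree in units of `m / Λ ^ 2`, rounded up by the `+ 1`. A degree missing from the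
  -- statistics is at most `m / p`, and one chunk is enough.
  chunks x j := (degreeStat stat x j).elim 0 (fun f => f * Λ ^ 2 / m) + 1

/-- The encoding of sets of edges in messages. -/
noncomputable def encode (S : Finset (Edge k n)) : List Bool :=
  (exists_encoding (Edge k n)).choose S

noncomputable def decode : List Bool → Finset (Edge k n) := Function.invFun encode

theorem decode_encode (S : Finset (Edge k n)) : decode (encode S) = S :=
  Function.leftInverse_invFun (exists_encoding (Edge k n)).choose_spec.1 S

theorem length_encode (S : Finset (Edge k n)) :
    (encode S).length = S.card * (Nat.clog 2 (Fintype.card (Edge k n)) + 1) :=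
  (exists_encoding (Edge k n)).choose_spec.2 S

open Classical in
/-- The edges received in the previous round. -/
noncomputable def lastReceived (h : List (Fin p → List Bool)) : Finset (Edge k n) :=
  univ.biUnion fun s => decode ((h.headD fun _ => []) s)

/-- The MPC algorithm for the clique query. Only the last two rounds are used. -/
noncomputable def cliqueAlgorithm (k n p m Λ : ℕ) [NeZero p] :
    (ConjQuery.clique k).Algorithm n p where
  Seed := (Fin k → Fin n → Fin (Λ ^ 2 + 1)) ×
    (Vertex k n × Vertex k n × Fin k × Fin (Λ ^ 2 + 1) → Fin p)
  send s' stat ω x h s :=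
    if h.length = k - 3 then
      encode ((layout Λ m stat).semijoinMsg ω.1 ω.2 (edges x) s)
    else if h.length = k - 2 then
      encode ((layout Λ m stat).finalMsg ω.1 ω.2 (edges x) (lastReceived h) s' s)
    else []
  output _ _ _ _ h := cliques (lastReceived h)

theorem send_cliqueAlgorithm {m Λ : ℕ} [NeZero p] (s' s : Fin p)
    (stat : (ConjQuery.clique k).Stats n) (ω : (cliqueAlgorithm k n p m Λ).Seed)
    (x : (ConjQuery.clique k).Instance n) (h : List (Fin p → List Bool)) :
    (cliqueAlgorithm k n p m Λ).send s' stat ω x h s =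
      if h.length = k - 3 then
        encode ((layout Λ m stat).semijoinMsg ω.1 ω.2 (edges x) s)
      else if h.length = k - 2 then
        encode ((layout Λ m stat).finalMsg ω.1 ω.2 (edges x) (lastReceived h) s' s)
      else [] := rfl

theorem length_history {Input Stat Out : Type} (A : MPCAlgorithm Input Stat Out p) (stat : Stat)
    (ω : A.Seed) (x : Fin p → Input) (r : ℕ) (s : Fin p) :
    (A.history stat ω x r s).length = r := by
  induction r with
  | zero => rfl
  | succ r ih => simp [MPCAlgorithm.history, ih]

section execution

variable {m Λ : ℕ} [NeZero p] (stat : (ConjQuery.clique k).Stats n)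
  (ω : (cliqueAlgorithm k n p m Λ).Seed) (x : Fin p → (ConjQuery.clique k).Instance n)

open Classical in
/-- The edges that the server `s` receives for the semijoins. -/
noncomputable def known (s : Fin p) : Finset (Edge k n) :=
  univ.biUnion fun s' => (layout Λ m stat).semijoinMsg ω.1 ω.2 (edges (x s')) s

theorem lastReceived_semijoin (hk : 3 ≤ k) (s : Fin p) :
    lastReceived ((cliqueAlgorithm k n p m Λ).history stat ω x (k - 2) s) =
      known (m := m) (Λ := Λ) stat ω x s := by
  rw [show k - 2 = (k - 3) + 1 by omega]
  simp only [lastReceived, known, MPCAlgorithm.history, List.headD_cons, send_cliqueAlgorithm,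
    length_history, if_true, decode_encode]

theorem lastReceived_final (hk : 3 ≤ k) (s : Fin p) :
    lastReceived ((cliqueAlgorithm k n p m Λ).history stat ω x (k - 1) s) =
      univ.biUnion fun s' => (layout Λ m stat).finalMsg ω.1 ω.2 (edges (x s'))
        (known (m := m) (Λ := Λ) stat ω x s') s' s := by
  have h : lastReceived (k := k) (n := n)
      ((cliqueAlgorithm k n p m Λ).history stat ω x (k - 1) s) = univ.biUnion fun s' => decode ((cliqueAlgorithm k n p m Λ).send s' stat ω (x s')
        ((cliqueAlgorithm k n p m Λ).history stat ω x (k - 2) s') s) := by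
    rw [show k - 1 = (k - 2) + 1 by omega]
    rfl
  simp only [h, send_cliqueAlgorithm, length_history, show k - 2 ≠ k - 3 by omega, if_true,
    if_false, decode_encode, lastReceived_semijoin stat ω x hk]

theorem received_eq (hk : 3 ≤ k) (s : Fin p) (r : ℕ) :
    (cliqueAlgorithm k n p m Λ).received stat ω x r s = (if r = k - 3 then
      ∑ s', ((layout Λ m stat).semijoinMsg ω.1 ω.2 (edges (x s')) s).card
    else if r = k - 2 then
      ∑ s', ((layout Λ m stat).finalMsg ω.1 ω.2 (edges (x s'))
        (known (m := m) (Λ := Λ) stat ω x s') s' s).card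
    else 0) * (Nat.clog 2 (Fintype.card (Edge k n)) + 1) := by
  simp only [MPCAlgorithm.received, send_cliqueAlgorithm, length_history]
  split_ifs with h1 h2
  · simp only [length_encode, sum_mul]
  · simp only [length_encode, sum_mul, h2, lastReceived_semijoin stat ω x hk]
  · simp

end execution

theorem chunks_layout_pos (Λ m : ℕ) (stat : (ConjQuery.clique k).Stats n) (x : Vertex k n)
    (j : Fin k) : 0 < (layout Λ m stat).chunks x j := Nat.succ_pos _

theorem mem_edges_comm (I : (ConjQuery.clique k).Instance n) {x y : Vertex k n} :
    (x, y) ∈ edges I ↔ (y, x) ∈ edges I := by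
  simp [edges, adj_comm I x y]

theorem known_subset {m Λ : ℕ} [NeZero p] (stat : (ConjQuery.clique k).Stats n)
    (ω : (cliqueAlgorithm k n p m Λ).Seed) (I : (ConjQuery.clique k).Instance n)
    (π : (ConjQuery.clique k).Placement n p) (s : Fin p) :
    known (m := m) (Λ := Λ) stat ω ((ConjQuery.clique k).localPart I π) s ⊆ edges I := by
  classical
  intro e he
  obtain ⟨s', -, h⟩ := mem_biUnion.1 he
  exact edges_localPart_subset I π s' (mem_filter.1 h).1

/-- The algorithm computes the clique query. -/
theorem result_cliqueAlgorithm {m Λ : ℕ} [NeZero p] (hk : 3 ≤ k) (hΛ : 0 < Λ)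
    (stat : (ConjQuery.clique k).Stats n) (ω : (cliqueAlgorithm k n p m Λ).Seed)
    (I : (ConjQuery.clique k).Instance n) (π : (ConjQuery.clique k).Placement n p) :
    (cliqueAlgorithm k n p m Λ).result stat ω ((ConjQuery.clique k).localPart I π) (k - 1) =
      (ConjQuery.clique k).answer I := by
  classical
  have hres : ∀ t, t ∈ (cliqueAlgorithm k n p m Λ).result stat ω
      ((ConjQuery.clique k).localPart I π) (k - 1) ↔
      ∃ s, t ∈ cliques (lastReceived ((cliqueAlgorithm k n p m Λ).history stat ω
        ((ConjQuery.clique k).localPart I π) (k - 1) s)) := fun t => Iff.rfl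
  ext t
  simp only [hres, mem_answer_iff, lastReceived_final stat ω _ hk]
  constructor
  · rintro ⟨s, hs⟩ i j hij
    have hsub : ∀ e ∈ univ.biUnion (fun s' => (layout Λ m stat).finalMsg ω.1 ω.2
        (edges ((ConjQuery.clique k).localPart I π s'))
        (known (m := m) (Λ := Λ) stat ω ((ConjQuery.clique k).localPart I π) s') s' s),
        e ∈ edges I := by
      intro e he
      obtain ⟨s', -, he⟩ := mem_biUnion.1 he
      rcases mem_union.1 he with he | he
      · exact edges_localPart_subset I π s' (mem_filter.1 he).1
      · exact known_subset stat ω I π s' (mem_filter.1 he).1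
    simp only [cliques, mem_filter, mem_univ, true_and] at hs
    rcases hs i j hij with h | h
    · exact hsub _ h
    · exact (mem_edges_comm I).1 (hsub _ h)
  · intro ht
    refine exists_mem_cliques (layout Λ m stat) ω.1 ω.2 (E := edges I)
      (D := fun s => edges ((ConjQuery.clique k).localPart I π s))
      (K := known (m := m) (Λ := Λ) stat ω ((ConjQuery.clique k).localPart I π))
      (by omega) hΛ (chunks_layout_pos Λ m stat)
      (fun x y => (mem_edges_comm I).1) (fun e he => exists_mem_edges_localPart I π he)
      (fun s s' => ?_) (fun s s' => ?_) ht
    · exact subset_biUnion_of_mem (fun s' => (layout Λ m stat).semijoinMsg ω.1 ω.2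
        (edges ((ConjQuery.clique k).localPart I π s')) s) (mem_univ s')
    · exact subset_biUnion_of_mem (fun s' => (layout Λ m stat).finalMsg ω.1 ω.2
        (edges ((ConjQuery.clique k).localPart I π s'))
        (known (m := m) (Λ := Λ) stat ω ((ConjQuery.clique k).localPart I π) s') s' s)
        (mem_univ s')

end CliqueMPC

/-! ### Properties of random hash functions -/

namespace CliqueMPC

open Finset

variable {k n p N : ℕ}

open Classical in
/-- The number of edges from `x` to the values of the variable `x_j`. -/
noncomputable def degree (E : Finset (Edge k n)) (x : Vertex k n) (j : Fin k) : ℕ :=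
  (univ.filter fun b => (x, (j, b)) ∈ E).card

/-- The properties of the input and the layout that are used for bounding the load: `l` is
`p ^ (1 / k)`, and `W` is `m / p ^ (2 / k)`. -/
structure Regular (E : Finset (Edge k n)) (P : Layout k n) (p N : ℕ) (l W : ℝ) : Prop where
  one_le_bound : 1 ≤ W
  one_le_root : 1 ≤ l
  root_pow_eq : l ^ k = p
  root_cube_le : l ^ 3 ≤ p
  root_le_side : l ≤ P.side
  side_le_root : P.side ≤ 2 * l
  side_le_range : P.side ≤ N
  range_le : (N : ℝ) ≤ 5 * p
  symm : ∀ x y, (x, y) ∈ E → (y, x) ∈ E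
  ne : ∀ x y, (x, y) ∈ E → x.1 ≠ y.1
  sum_degree_le : ∀ i j, ∑ a, (degree E (i, a) j : ℝ) ≤ l ^ 2 * W
  degree_le_of_light : ∀ x j, ¬ P.heavy x → (degree E x j : ℝ) ≤ l * W
  card_heavy_le : ∀ (i : Fin k) (A : Finset (Fin n)), (∀ a ∈ A, P.heavy (i, a)) →
    A.card ≤ k * P.side
  degree_le : ∀ x j, (degree E x j : ℝ) ≤ P.chunks x j * W
  chunks_pos : ∀ x j, 0 < P.chunks x j
  chunks_le : ∀ x j, P.chunks x j ≤ N
  sum_chunks_le : ∀ (i j : Fin k) (A : Finset (Fin n)),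
    ∑ a ∈ A, P.chunks (i, a) j ≤ A.card + P.side ^ 2

open Classical in
/-- The number of edges from `x` to the light values of the variable `x_j` whose hash value has the
residue `r` modulo `c`. -/
noncomputable def residueCount (E : Finset (Edge k n)) (P : Layout k n)
    (u : Fin k → Fin n → Fin N) (x : Vertex k n) (j : Fin k) (c r : ℕ) : ℕ :=
  (univ.filter fun b => (x, (j, b)) ∈ E ∧ ¬ P.heavy (j, b) ∧ (u j b : ℕ) % c = r).card

/-- The hash functions split the neighbourhoods evenly. -/
def SplitsDegrees (E : Finset (Edge k n)) (P : Layout k n) (W t : ℝ)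
    (u : Fin k → Fin n → Fin N) : Prop :=
  ∀ x j c r, 1 ≤ c → c ≤ N → (degree E x j : ℝ) ≤ c * W →
    (residueCount E P u x j c r : ℝ) ≤ t * W

open Classical in
/-- The number of edges between light vertices with prescribed buckets. -/
noncomputable def bucketCount (E : Finset (Edge k n)) (P : Layout k n)
    (u : Fin k → Fin n → Fin N) (i j : Fin k) (r r' : ℕ) : ℕ :=
  ∑ b, if (u j b : ℕ) % P.side = r' then
    if P.heavy (j, b) then 0 else residueCount E P u (j, b) i P.side r else 0

/-- The hash functions split the sets of edges between light vertices evenly. -/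
def SplitsEdges (E : Finset (Edge k n)) (P : Layout k n) (W t : ℝ)
    (u : Fin k → Fin n → Fin N) : Prop :=
  ∀ i j r r', i ≠ j → (bucketCount E P u i j r r' : ℝ) ≤ t * (t * W)

variable {E : Finset (Edge k n)} {P : Layout k n} {l W t : ℝ}

theorem residueCount_le_degree (u : Fin k → Fin n → Fin N) (x : Vertex k n) (j : Fin k)
    (c r : ℕ) : residueCount E P u x j c r ≤ degree E x j := by
  classical
  exact card_le_card (monotone_filter_right _ fun b _ hb => hb.1)

open Classical in
theorem residueCount_eq_sum (u : Fin k → Fin n → Fin N) (x : Vertex k n) (j : Fin k) (c r : ℕ) :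
    (residueCount E P u x j c r : ℝ) = ∑ b, if (u j b : ℕ) % c = r then
      (if (x, (j, b)) ∈ E ∧ ¬ P.heavy (j, b) then (1 : ℝ) else 0) else 0 := by
  rw [residueCount, card_filter]
  push_cast
  refine sum_congr rfl fun b _ => ?_
  split_ifs <;> first | rfl | tauto

theorem pr_eq_zero {Ω : Type*} [Fintype Ω] {B : Ω → Prop} (h : ∀ ω, ¬ B ω) : pr B = 0 := by
  classical
  rw [pr_def, filter_false_of_mem fun ω _ => h ω]
  simp

theorem lt_of_residueCount_pos (u : Fin k → Fin n → Fin N) (x : Vertex k n) (j : Fin k)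
    {c r : ℕ} (hc : 1 ≤ c) (h : 0 < residueCount E P u x j c r) : r < c := by
  classical
  obtain ⟨b, hb⟩ := card_pos.1 h
  obtain ⟨-, -, -, rfl⟩ := mem_filter.1 hb
  exact Nat.mod_lt _ hc

namespace Regular

variable (h : Regular E P p N l W)
include h

theorem side_pos : 0 < P.side := by
  have := h.one_le_root.trans h.root_le_side
  exact_mod_cast lt_of_lt_of_le one_pos this

theorem range_pos : 0 < N := h.side_pos.trans_le h.side_le_range

theorem root_sq_le : l ^ 2 ≤ p :=
  (pow_le_pow_right₀ h.one_le_root (by norm_num)).trans h.root_cube_le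

/-- Only the hash function of `x_j` matters, so the others are fixed. The expected count is at most
`(2 / c) * (c * W) = 2 * W`, hence the exponent `4 - t`. -/
theorem pr_residueCount_le (x : Vertex k n) (j : Fin k) {c : ℕ} (r : ℕ) (hc : 1 ≤ c)
    (hcN : c ≤ N) (hdeg : (degree E x j : ℝ) ≤ c * W) :
    pr (fun u : Fin k → Fin n → Fin N => t * W < residueCount E P u x j c r) ≤
      Real.exp (4 - t) := by
  classical
  have : Nonempty (Fin N) := ⟨⟨0, h.range_pos⟩⟩
  have hW := h.one_le_bound
  have hc' : (0 : ℝ) < c := by exact_mod_cast hc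
  refine pr_update_le j (Real.exp_pos _).le fun u => ?_
  have := pr_weight_le (X := Fin n) (Y := Fin N) (fun _ y => (y : ℕ) % c = r)
    (fun b => if (x, (j, b)) ∈ E ∧ ¬ P.heavy (j, b) then (1 : ℝ) else 0)
    (W := W) (q := 2 / c) (μ := 2) (t := t) (by linarith)
    (fun b => by split_ifs <;> norm_num) (fun b => by split_ifs <;> linarith)
    (fun _ => card_mod_eq_le hc hcN r) ?_
  · refine (pr_mono fun f hf => ?_).trans (this.trans_eq (by norm_num))
    rw [residueCount_eq_sum] at hf
    simpa using hf
  · have h1 : ∑ b, (if (x, (j, b)) ∈ E ∧ ¬ P.heavy (j, b) then (1 : ℝ) else 0) ≤ degree E x j := by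
      rw [degree, card_filter]
      push_cast
      refine sum_le_sum fun b _ => ?_
      split_ifs <;> first | exact le_rfl | exact zero_le_one | (exfalso; tauto)
    calc _ ≤ 2 / (c : ℝ) * (c * W) := by gcongr; exact h1.trans hdeg
      _ = 2 * W := by field_simp

/-- Markov's inequality for the sum of the degrees. It makes the number of events in the union bound
polynomial in `p` and independent of `n`. -/
theorem card_degree_gt_le :
    (((univ : Finset (Vertex k n × Fin k)).filter fun y => W < degree E y.1 y.2).card : ℝ) ≤
      k ^ 2 * p := by
  have hW := h.one_le_bound
  have h1 : (((univ : Finset (Vertex k n × Fin k)).filter fun y => W < degree E y.1 y.2).card : ℝ)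
      * W ≤ k ^ 2 * (l ^ 2 * W) := by
    calc _ = ∑ y ∈ (univ : Finset (Vertex k n × Fin k)).filter fun y => W < degree E y.1 y.2, W := by
          simp
      _ ≤ ∑ y ∈ (univ : Finset (Vertex k n × Fin k)).filter fun y => W < degree E y.1 y.2,
            (degree E y.1 y.2 : ℝ) := sum_le_sum fun y hy => (mem_filter.1 hy).2.le
      _ ≤ ∑ y : Vertex k n × Fin k, (degree E y.1 y.2 : ℝ) :=
          sum_le_sum_of_subset_of_nonneg (filter_subset _ _) fun _ _ _ => Nat.cast_nonneg _
      _ = ∑ i : Fin k, ∑ j : Fin k, ∑ a : Fin n, (degree E (i, a) j : ℝ) := by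
          rw [Fintype.sum_prod_type, Fintype.sum_prod_type]
          exact sum_congr rfl fun i _ => sum_comm
      _ ≤ ∑ i : Fin k, ∑ j : Fin k, l ^ 2 * W :=
          sum_le_sum fun i _ => sum_le_sum fun j _ => h.sum_degree_le i j
      _ = _ := by simp; ring
  have h2 : (k ^ 2 * (l ^ 2 * W) : ℝ) ≤ k ^ 2 * p * W := by
    rw [← mul_assoc]
    gcongr
    exact h.root_sq_le
  exact le_of_mul_le_mul_right (h1.trans h2) (by linarith)

/-- As `t ≥ 1`, a failure forces a degree above `W`, which leaves at most `k ^ 2 * p` pairs `(x,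
j)`; there are at most `N ^ 2 ≤ 25 * p ^ 2` choices of modulus and residue. -/
theorem pr_not_splitsDegrees (ht : 1 ≤ t) :
    pr (fun u : Fin k → Fin n → Fin N => ¬ SplitsDegrees E P W t u) ≤
      25 * k ^ 2 * p ^ 3 * Real.exp (4 - t) := by
  classical
  have hW := h.one_le_bound
  set S := ((univ : Finset (Vertex k n × Fin k)).filter fun y => W < degree E y.1 y.2) ×ˢ
    (Icc 1 N ×ˢ range N) with hS
  have h1 := pr_exists_le (Ω := Fin k → Fin n → Fin N) S (fun y u =>
    (degree E y.1.1 y.1.2 : ℝ) ≤ y.2.1 * W ∧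
      t * W < residueCount E P u y.1.1 y.1.2 y.2.1 y.2.2) (ε := Real.exp (4 - t)) ?_
  · refine (pr_mono fun u hu => ?_).trans (h1.trans ?_)
    · simp only [SplitsDegrees, not_forall, not_le] at hu
      obtain ⟨x, j, c, r, hc, hcN, hdeg, hlt⟩ := hu
      refine ⟨((x, j), c, r), ?_, hdeg, hlt⟩
      have hlt' : W < residueCount E P u x j c r := by nlinarith
      simp only [hS, mem_product, mem_filter, mem_univ, true_and, mem_Icc, mem_range]
      refine ⟨hlt'.trans_le (by exact_mod_cast residueCount_le_degree u x j c r), ⟨hc, hcN⟩, ?_⟩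
      refine (lt_of_residueCount_pos (E := E) (P := P) u x j hc ?_).trans_le hcN
      exact_mod_cast lt_trans (by linarith : (0 : ℝ) < W) hlt'
    · gcongr
      rw [hS, card_product, card_product]
      push_cast
      have h2 := h.card_degree_gt_le
      have h3 := h.range_le
      simp only [Nat.card_Icc, card_range, Nat.add_sub_cancel]
      calc _ ≤ (k ^ 2 * p : ℝ) * ((5 * p) * (5 * p)) := by gcongr
        _ = _ := by ring
  · rintro ⟨⟨x, j⟩, c, r⟩ hy
    simp only [hS, mem_product, mem_Icc] at hy
    by_cases hdeg : (degree E x j : ℝ) ≤ c * W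
    · exact (pr_mono fun u hu => hu.2).trans (h.pr_residueCount_le x j r hy.2.1.1 hy.2.1.2 hdeg)
    · rw [pr_eq_zero fun u hu => hdeg hu.1]
      exact (Real.exp_pos _).le

/-- Double counting: the edges into the bucket `r` of `x_i` are summed from the side of `x_i`, where
symmetry of `E` turns them into degrees. -/
theorem sum_residueCount (u : Fin k → Fin n → Fin N) (i j : Fin k) (r : ℕ) :
    open Classical in
    ∑ b, (if P.heavy (j, b) then 0 else (residueCount E P u (j, b) i P.side r : ℝ)) ≤
      ∑ a, if (u i a : ℕ) % P.side = r then
        (if P.heavy (i, a) then 0 else (degree E (i, a) j : ℝ)) else 0 := by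
  classical
  calc _ ≤ ∑ b, (residueCount E P u (j, b) i P.side r : ℝ) := by
        refine sum_le_sum fun b _ => ?_
        split_ifs <;> simp
    _ = ∑ a, ∑ b, if (u i a : ℕ) % P.side = r then
      (if ((j, b), (i, a)) ∈ E ∧ ¬ P.heavy (i, a) then (1 : ℝ) else 0) else 0 := by
        simp_rw [residueCount_eq_sum]
        exact sum_comm
    _ ≤ _ := by
        refine sum_le_sum fun a _ => ?_
        by_cases h1 : (u i a : ℕ) % P.side = r
        · by_cases h2 : P.heavy (i, a)
          · simp [h1, h2]
          · simp only [h1, h2, if_true, if_false, not_false_eq_true, and_true]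
            rw [degree, card_filter]
            push_cast
            refine sum_le_sum fun b _ => ?_
            split_ifs with h3 h4
            · rfl
            · exact absurd (h.symm _ _ h3) h4
            · norm_num
            · rfl
        · simp [h1]

/-- The bucket `r` of `x_i` contains few edges between the variables `x_i` and `x_j`, evenly
distributed over the values of `x_j`. -/
theorem pr_bucketCount_le (ht : 1 ≤ t) {i j : Fin k} (hij : i ≠ j) (r r' : ℕ) :
    pr (fun u : Fin k → Fin n → Fin N => SplitsDegrees E P W t u ∧
      t * (t * W) < bucketCount E P u i j r r') ≤ 2 * Real.exp (4 - t) := by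
  classical
  have : Nonempty (Fin N) := ⟨⟨0, h.range_pos⟩⟩
  have hW := h.one_le_bound
  have hl := h.one_le_root
  have hls := h.root_le_side
  have hside : (0 : ℝ) < P.side := by exact_mod_cast h.side_pos
  let w : (Fin k → Fin n → Fin N) → Fin n → ℝ := fun u b =>
    if P.heavy (j, b) then 0 else (residueCount E P u (j, b) i P.side r : ℝ)
  -- First stage: at most `t * (l * W)` edges go to the bucket `r` of `x_i`. This depends on `u i`
  -- alone, and each light vertex has weight at most `l * W`.
  let Q : (Fin k → Fin n → Fin N) → Prop := fun u => ∑ b, w u b ≤ t * (l * W)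
  have hbucket : ∀ u, (bucketCount E P u i j r r' : ℝ) =
      ∑ b, if (u j b : ℕ) % P.side = r' then w u b else 0 := by
    intro u
    simp only [bucketCount, w]
    push_cast
    exact sum_congr rfl fun b _ => by split_ifs <;> rfl
  -- The weights do not involve `u j`, as `i ≠ j`. So a second stage can hash `x_j` independently,
  -- with weights at most `t * W`; this is where the second factor `t` arises.
  have hwup : ∀ u f, w (Function.update u j f) = w u := by
    intro u f
    funext b
    simp only [w, residueCount, Function.update_of_ne hij]
  have h1 : pr (fun u : Fin k → Fin n → Fin N => ¬ Q u) ≤ Real.exp (4 - t) := by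
    refine pr_update_le i (Real.exp_pos _).le fun u => ?_
    have := pr_weight_le (X := Fin n) (Y := Fin N) (fun _ y => (y : ℕ) % P.side = r)
      (fun a => if P.heavy (i, a) then 0 else (degree E (i, a) j : ℝ))
      (W := l * W) (q := 2 / P.side) (μ := 2) (t := t) (by positivity)
      (fun b => by split_ifs <;> positivity)
      (fun b => by
        split_ifs with hb
        · positivity
        · exact h.degree_le_of_light _ _ hb)
      (fun _ => card_mod_eq_le h.side_pos h.side_le_range r) ?_
    · refine (pr_mono fun f hf => ?_).trans (this.trans_eq (by norm_num))
      have := (not_le.1 hf).trans_le (h.sum_residueCount _ i j r)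
      simpa using this
    · calc _ ≤ 2 / (P.side : ℝ) * (l ^ 2 * W) := by
            gcongr
            refine le_trans (sum_le_sum fun a _ => ?_) (h.sum_degree_le i j)
            split_ifs <;> simp
        _ = 2 * (l / P.side) * (l * W) := by ring
        _ ≤ 2 * 1 * (l * W) := by
            gcongr
            exact (div_le_one hside).2 hls
        _ = _ := by ring
  have h2 : pr (fun u : Fin k → Fin n → Fin N => Q u ∧ (∀ b, w u b ≤ t * W) ∧
      t * (t * W) < bucketCount E P u i j r r') ≤ Real.exp (4 - t) := by
    refine pr_update_le j (Real.exp_pos _).le fun u => ?_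
    by_cases hQ : Q u ∧ ∀ b, w u b ≤ t * W
    · have := pr_weight_le (X := Fin n) (Y := Fin N) (fun _ y => (y : ℕ) % P.side = r') (w u)
        (W := t * W) (q := 2 / P.side) (μ := 2) (t := t) (by positivity)
        (fun b => by simp only [w]; split_ifs <;> positivity) hQ.2
        (fun _ => card_mod_eq_le h.side_pos h.side_le_range r') ?_
      · refine (pr_mono fun f hf => ?_).trans (this.trans_eq (by norm_num))
        have := hf.2.2
        rw [hbucket, hwup] at this
        simpa using this
      · calc _ ≤ 2 / (P.side : ℝ) * (t * (l * W)) := by gcongr; exact hQ.1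
          _ = 2 * (l / P.side) * (t * W) := by ring
          _ ≤ 2 * 1 * (t * W) := by
              gcongr
              exact (div_le_one hside).2 hls
          _ = _ := by ring
    · rw [pr_eq_zero fun f hf => hQ ?_]
      · exact (Real.exp_pos _).le
      · have h3 := hf.1
        have h4 := hf.2.1
        simp only [Q, hwup] at h3 h4
        exact ⟨h3, h4⟩
  have h3 := pr_or_le (fun u : Fin k → Fin n → Fin N => ¬ Q u) (fun u => Q u ∧
    (∀ b, w u b ≤ t * W) ∧ t * (t * W) < bucketCount E P u i j r r')
  refine (pr_mono fun u hu => ?_).trans (h3.trans (by linarith))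
  by_cases hQ : Q u
  · refine Or.inr ⟨hQ, fun b => ?_, hu.2⟩
    simp only [w]
    split_ifs with hb
    · positivity
    · refine hu.1 _ _ _ _ h.side_pos h.side_le_range ((h.degree_le_of_light _ _ hb).trans ?_)
      gcongr
  · exact Or.inl hQ

theorem pr_not_splitsEdges (ht : 1 ≤ t) :
    pr (fun u : Fin k → Fin n → Fin N => SplitsDegrees E P W t u ∧ ¬ SplitsEdges E P W t u) ≤
      8 * k ^ 2 * p ^ 3 * Real.exp (4 - t) := by
  classical
  have hW := h.one_le_bound
  have hl := h.one_le_root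
  set S := ((univ : Finset (Fin k × Fin k)).filter fun y => y.1 ≠ y.2) ×ˢ
    (range P.side ×ˢ range P.side) with hS
  have h1 := pr_exists_le (Ω := Fin k → Fin n → Fin N) S (fun y u => SplitsDegrees E P W t u ∧
      t * (t * W) < bucketCount E P u y.1.1 y.1.2 y.2.1 y.2.2) (ε := 2 * Real.exp (4 - t)) ?_
  · refine (pr_mono fun u hu => ?_).trans (h1.trans ?_)
    · obtain ⟨hu, hu'⟩ := hu
      simp only [SplitsEdges, not_forall, not_le] at hu'
      obtain ⟨i, j, r, r', hij, hlt⟩ := hu'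
      refine ⟨((i, j), r, r'), ?_, hu, hlt⟩
      have hpos : 0 < bucketCount E P u i j r r' := by
        have : (0 : ℝ) < t * (t * W) := by positivity
        exact_mod_cast this.trans hlt
      obtain ⟨b, -, hb⟩ := exists_ne_zero_of_sum_ne_zero hpos.ne'
      have hr' : (u j b : ℕ) % P.side = r' := by by_contra h'; simp [h'] at hb
      have hb' : ¬ P.heavy (j, b) := by intro h'; simp [h'] at hb
      simp only [hr', hb', if_true, if_false] at hb
      simp only [hS, mem_product, mem_filter, mem_univ, true_and, mem_range]
      exact ⟨hij, lt_of_residueCount_pos u _ i h.side_pos (Nat.pos_of_ne_zero hb),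
        hr' ▸ Nat.mod_lt _ h.side_pos⟩
    · have hcard : (S.card : ℝ) ≤ k ^ 2 * (P.side * P.side) := by
        rw [hS, card_product, card_product, card_range]
        push_cast
        gcongr
        refine (Nat.cast_le.2 (card_filter_le _ _)).trans_eq ?_
        simp [sq]
      have hp : (1 : ℝ) ≤ p := (one_le_pow₀ hl).trans h.root_cube_le
      calc _ ≤ (k ^ 2 * ((2 * l) * (2 * l)) : ℝ) * (2 * Real.exp (4 - t)) := by
            gcongr
            refine hcard.trans ?_
            gcongr <;> exact h.side_le_root
        _ = 8 * k ^ 2 * l ^ 2 * Real.exp (4 - t) := by ring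
        _ ≤ _ := by
            gcongr
            exact h.root_sq_le.trans (le_self_pow₀ hp (by norm_num))
  · rintro ⟨⟨i, j⟩, r, r'⟩ hy
    simp only [hS, mem_product, mem_filter, mem_univ, true_and] at hy
    exact h.pr_bucketCount_le ht hy.1 r r'

end Regular

end CliqueMPC

/-! ### The routing of the edges in the semijoin round -/

namespace CliqueMPC

open Finset

variable {k n p N : ℕ} {E : Finset (Edge k n)} {P : Layout k n} {l W t : ℝ}

open Classical in
/-- The number of edges between light vertices that are sent to the destination of `θ`. -/
noncomputable def lightWeight (E : Finset (Edge k n)) (P : Layout k n)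
    (u : Fin k → Fin n → Fin N) (θ : Vertex k n × Vertex k n × Fin k × Fin N) : ℕ :=
  if P.heavy θ.1 ∧ ¬ P.heavy θ.2.1 then
    residueCount E P u θ.2.1 θ.2.2.1 (P.chunks θ.2.1 θ.2.2.1) θ.2.2.2 else 0

open Classical in
/-- The number of edges at heavy vertices that are sent to the destination of `θ`. -/
noncomputable def heavyWeight (E : Finset (Edge k n)) (P : Layout k n)
    (θ : Vertex k n × Vertex k n × Fin k × Fin N) : ℕ :=
  if P.heavy θ.1 ∧ (θ.1, θ.2.1) ∈ E ∧ (θ.2.2.2 : ℕ) < P.chunks θ.2.1 θ.2.2.1 then 1 else 0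

open Classical in
-- Each edge that reaches `s` has a label `θ` (heavy vertex, middle vertex, variable, chunk) routed
-- there by `G`. Summing over labels turns the load into a weighted hashing sum.
theorem card_sendsLight_le (u : Fin k → Fin n → Fin N)
    (G : Vertex k n × Vertex k n × Fin k × Fin N → Fin p) (s : Fin p) :
    (E.filter (P.SendsLight u G s)).card ≤
      ∑ θ, if G θ = s then lightWeight E P u θ else 0 := by
  set T := (univ.filter fun θ => G θ = s ∧ P.heavy θ.1 ∧ ¬ P.heavy θ.2.1).sigma fun θ =>
    univ.filter fun b => (θ.2.1, (θ.2.2.1, b)) ∈ E ∧ ¬ P.heavy (θ.2.2.1, b) ∧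
      (u θ.2.2.1 b : ℕ) % P.chunks θ.2.1 θ.2.2.1 = θ.2.2.2 with hT
  have h1 : E.filter (P.SendsLight u G s) ⊆ T.image fun y => (y.1.2.1, (y.1.2.2.1, y.2)) := by
    rintro ⟨y, z⟩ he
    obtain ⟨he, hy, hz, x, hx, hs⟩ := mem_filter.1 he
    refine mem_image.2 ⟨⟨(x, y, z.1, P.chunk u y z), z.2⟩, ?_, rfl⟩
    simp only [hT, mem_sigma, mem_filter, mem_univ, true_and]
    exact ⟨⟨hs, hx, hy⟩, he, hz, rfl⟩
  refine (card_le_card h1).trans (card_image_le.trans ?_)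
  rw [hT, card_sigma, sum_filter]
  refine sum_le_sum fun θ _ => ?_
  unfold lightWeight residueCount
  by_cases h1 : G θ = s <;> by_cases h2 : P.heavy θ.1 ∧ ¬ P.heavy θ.2.1
  · rw [if_pos ⟨h1, h2⟩, if_pos h1, if_pos h2]
  · rw [if_neg fun h => h2 h.2]; exact Nat.zero_le _
  · rw [if_neg fun h => h1 h.1]; exact Nat.zero_le _
  · rw [if_neg fun h => h1 h.1]; exact Nat.zero_le _

open Classical in
theorem card_sendsHeavy_le (G : Vertex k n × Vertex k n × Fin k × Fin N → Fin p) (s : Fin p) :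
    (E.filter (P.SendsHeavy G s)).card ≤
      ∑ θ, if G θ = s then heavyWeight E P θ else 0 := by
  set T := univ.filter fun θ => G θ = s ∧ P.heavy θ.1 ∧ (θ.1, θ.2.1) ∈ E ∧
    (θ.2.2.2 : ℕ) < P.chunks θ.2.1 θ.2.2.1 with hT
  have h1 : E.filter (P.SendsHeavy G s) ⊆ T.image fun θ => (θ.1, θ.2.1) := by
    rintro ⟨x, y⟩ he
    obtain ⟨he, hx, hy, j, r, hr, hs⟩ := mem_filter.1 he
    refine mem_image.2 ⟨(x, y, j, r), ?_, rfl⟩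
    simp only [hT, mem_filter, mem_univ, true_and]
    exact ⟨hs, hx, he, hr⟩
  refine (card_le_card h1).trans (card_image_le.trans ?_)
  rw [hT, card_filter]
  refine sum_le_sum fun θ _ => ?_
  unfold heavyWeight
  by_cases h1 : G θ = s
  · simp [h1]
  · simp [h1]

theorem sum_residueCount_le (u : Fin k → Fin n → Fin N) (x : Vertex k n) (j : Fin k) (c : ℕ) :
    ∑ r : Fin N, residueCount E P u x j c r ≤ degree E x j := by
  classical
  simp_rw [residueCount, degree, card_filter]
  rw [sum_comm]
  refine sum_le_sum fun b _ => ?_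
  by_cases hb : (x, (j, b)) ∈ E
  · rw [if_pos hb, ← card_filter]
    refine card_le_one.2 fun r hr r' hr' => ?_
    exact Fin.ext ((mem_filter.1 hr).2.2.2.symm.trans (mem_filter.1 hr').2.2.2)
  · simp [hb]

/-- With these hash functions no server receives many edges. -/
def Good (E : Finset (Edge k n)) (P : Layout k n) (W t : ℝ)
    (ω : (Fin k → Fin n → Fin N) × (Vertex k n × Vertex k n × Fin k × Fin N → Fin p)) : Prop :=
  open Classical in
  SplitsDegrees E P W t ω.1 ∧ SplitsEdges E P W t ω.1 ∧
    (∀ s, ((E.filter (P.SendsLight ω.1 ω.2 s)).card : ℝ) ≤ t * (t * W)) ∧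
    ∀ s, ((E.filter (P.SendsHeavy ω.2 s)).card : ℝ) ≤ t * W

namespace Regular

variable (h : Regular E P p N l W)
include h

theorem sum_sum_degree_le : ∑ x : Vertex k n, ∑ j, (degree E x j : ℝ) ≤ k ^ 2 * (l ^ 2 * W) := by
  calc _ = ∑ i : Fin k, ∑ j : Fin k, ∑ a : Fin n, (degree E (i, a) j : ℝ) := by
        rw [Fintype.sum_prod_type]
        exact sum_congr rfl fun i _ => sum_comm
    _ ≤ ∑ i : Fin k, ∑ j : Fin k, l ^ 2 * W :=
        sum_le_sum fun i _ => sum_le_sum fun j _ => h.sum_degree_le i j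
    _ = _ := by simp; ring

open Classical in
theorem card_heavy_univ_le : (univ.filter P.heavy).card ≤ k ^ 2 * P.side := by
  rw [card_filter, Fintype.sum_prod_type]
  simp_rw [← card_filter]
  calc _ ≤ ∑ i : Fin k, k * P.side :=
        sum_le_sum fun i _ => h.card_heavy_le i _ fun a ha => (mem_filter.1 ha).2
    _ = _ := by simp; ring

/-- Each light edge is counted once per heavy vertex, of which there are at most `k ^ 2 * (2 * l)`;
then `l ^ 3 ≤ p` absorbs the replication. -/
theorem sum_lightWeight_le (u : Fin k → Fin n → Fin N) :
    (∑ θ, (lightWeight E P u θ : ℝ)) ≤ 2 * k ^ 4 * (p * W) := by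
  classical
  have hW := h.one_le_bound
  have hl := h.one_le_root
  have h1 : ∑ θ, lightWeight E P u θ ≤ ∑ x ∈ univ.filter P.heavy, ∑ y, ∑ j, degree E y j := by
    rw [Fintype.sum_prod_type, sum_filter]
    refine sum_le_sum fun x _ => ?_
    rw [Fintype.sum_prod_type]
    split_ifs with hx
    · refine sum_le_sum fun y _ => ?_
      rw [Fintype.sum_prod_type]
      refine sum_le_sum fun j _ => ?_
      refine le_trans (sum_le_sum fun r _ => ?_) (sum_residueCount_le (P := P) u y j (P.chunks y j))
      unfold lightWeight
      split_ifs
      · exact le_rfl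
      · exact Nat.zero_le _
    · simp [lightWeight, hx]
  have h2 := h.sum_sum_degree_le
  have h3 : ((univ.filter P.heavy).card : ℝ) ≤ k ^ 2 * P.side := by
    exact_mod_cast h.card_heavy_univ_le
  calc (∑ θ, (lightWeight E P u θ : ℝ))
      ≤ ∑ x ∈ univ.filter P.heavy, ∑ y, ∑ j, (degree E y j : ℝ) := by exact_mod_cast h1
    _ = (univ.filter P.heavy).card * ∑ y, ∑ j, (degree E y j : ℝ) := by simp
    _ ≤ (k ^ 2 * (2 * l)) * (k ^ 2 * (l ^ 2 * W)) := by
        gcongr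
        exact h3.trans (by gcongr; exact h.side_le_root)
    _ = 2 * k ^ 4 * (l ^ 3 * W) := by ring
    _ ≤ _ := by gcongr; exact h.root_cube_le

/-- An edge `(x, y)` is counted once per chunk of `y`. Summed over the neighbours `y` of `x`, the
chunks number at most the degree plus `P.side ^ 2`, because the degrees of the `y` share one total.
-/
theorem sum_heavyWeight_le (hk : 1 ≤ k) :
    (∑ θ : Vertex k n × Vertex k n × Fin k × Fin N, (heavyWeight E P θ : ℝ)) ≤
      9 * k ^ 4 * (p * W) := by
  classical
  have hW := h.one_le_bound
  have hl := h.one_le_root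
  have hk' : (1 : ℝ) ≤ k := by exact_mod_cast hk
  have h1 : ∑ θ : Vertex k n × Vertex k n × Fin k × Fin N, heavyWeight E P θ ≤
      ∑ x ∈ univ.filter P.heavy, ∑ i : Fin k, ∑ j : Fin k, (degree E x i + P.side ^ 2) := by
    rw [Fintype.sum_prod_type, sum_filter]
    refine sum_le_sum fun x _ => ?_
    split_ifs with hx
    · rw [Fintype.sum_prod_type, Fintype.sum_prod_type]
      refine sum_le_sum fun i _ => ?_
      simp_rw [Fintype.sum_prod_type]
      rw [sum_comm]
      refine sum_le_sum fun j _ => ?_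
      refine le_trans ?_ (h.sum_chunks_le i j (univ.filter fun b => (x, (i, b)) ∈ E))
      rw [sum_filter]
      refine sum_le_sum fun a _ => ?_
      split_ifs with ha
      · simp only [heavyWeight, hx, ha, true_and]
        rw [← card_filter]
        refine (card_le_card_of_injOn (fun r : Fin N => (r : ℕ)) ?_
          fun r _ r' _ hr => Fin.ext hr).trans_eq (card_range (P.chunks (i, a) j))
        intro r hr
        simpa using hr
      · simp [heavyWeight, ha]
    · simp [heavyWeight, hx]
  have h2 := h.sum_sum_degree_le
  have h3 : ((univ.filter P.heavy).card : ℝ) ≤ k ^ 2 * P.side := by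
    exact_mod_cast h.card_heavy_univ_le
  have hside : (P.side : ℝ) ≤ 2 * l := h.side_le_root
  calc (∑ θ : Vertex k n × Vertex k n × Fin k × Fin N, (heavyWeight E P θ : ℝ))
      ≤ ∑ x ∈ univ.filter P.heavy, ∑ i : Fin k, ∑ j : Fin k,
          ((degree E x i : ℝ) + P.side ^ 2) := by exact_mod_cast h1
    _ = k * ∑ x ∈ univ.filter P.heavy, ∑ i, (degree E x i : ℝ) +
          (univ.filter P.heavy).card * (k ^ 2 * P.side ^ 2) := by
        simp only [sum_const, card_univ, Fintype.card_fin, nsmul_eq_mul, sum_add_distrib, mul_add,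
          ← mul_sum]
        ring
    _ ≤ k * (k ^ 2 * (l ^ 2 * W)) + (k ^ 2 * (2 * l)) * (k ^ 2 * (2 * l) ^ 2) := by
        gcongr
        · refine le_trans (sum_le_sum_of_subset_of_nonneg (filter_subset _ _) ?_) h2
          intro x _ _
          positivity
        · exact h3.trans (by gcongr)
    _ = k ^ 3 * (l ^ 2 * W) + 8 * k ^ 4 * (l ^ 3 * 1) := by ring
    _ ≤ k ^ 4 * (p * W) + 8 * k ^ 4 * (p * W) := by
        gcongr
        · norm_num
        · exact h.root_sq_le
        · exact h.root_cube_le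
    _ = _ := by ring

theorem one_le_servers : 1 ≤ p := by
  have := (one_le_pow₀ h.one_le_root (n := 3)).trans h.root_cube_le
  exact_mod_cast this

theorem pr_weight_route_le {w : Vertex k n × Vertex k n × Fin k × Fin N → ℝ} {B μ : ℝ}
    (hB : 0 < B) (hw0 : ∀ θ, 0 ≤ w θ) (hwB : ∀ θ, w θ ≤ B) (hμ : ∑ θ, w θ ≤ μ * (p * B))
    (s : Fin p) :
    pr (fun G : Vertex k n × Vertex k n × Fin k × Fin N → Fin p =>
      t * B < ∑ θ, if G θ = s then w θ else 0) ≤ Real.exp (2 * μ - t) := by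
  have : Nonempty (Fin p) := ⟨s⟩
  have hp : (0 : ℝ) < p := by exact_mod_cast h.one_le_servers
  refine pr_weight_le (fun _ y => y = s) w (q := 1 / p) hB hw0 hwB (fun _ => ?_) ?_
  · simp [filter_eq', hp.ne']
  · rw [div_mul_eq_mul_div, one_mul, div_le_iff₀ hp]
    linarith

/-- The weight of a label for light edges is at most `t * W` only if the hash functions split the
degrees, so these are fixed first and then only `G` is random. The constant `18 * k ^ 4` is `2 * μ`
for the heavy weights, and `35 = 25 + 8 + 1 + 1`. -/
theorem pr_not_good (hk : 1 ≤ k) (ht : 1 ≤ t) :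
    pr (fun ω : (Fin k → Fin n → Fin N) × (Vertex k n × Vertex k n × Fin k × Fin N → Fin p) =>
      ¬ Good E P W t ω) ≤ 35 * k ^ 2 * p ^ 3 * Real.exp (18 * k ^ 4 - t) := by
  classical
  have hW := h.one_le_bound
  have hk' : (1 : ℝ) ≤ k := by exact_mod_cast hk
  have hp' : (1 : ℝ) ≤ p := by exact_mod_cast h.one_le_servers
  have hk4 : (1 : ℝ) ≤ k ^ 4 := one_le_pow₀ hk'
  let Ω := (Fin k → Fin n → Fin N) × (Vertex k n × Vertex k n × Fin k × Fin N → Fin p)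
  have e1 : Real.exp (4 - t) ≤ Real.exp (18 * k ^ 4 - t) := by
    gcongr
    linarith
  have hpp : (p : ℝ) ≤ k ^ 2 * p ^ 3 := by
    calc (p : ℝ) = 1 * p ^ 1 := by ring
      _ ≤ k ^ 2 * p ^ 3 := by
        gcongr
        · exact one_le_pow₀ hk'
        · norm_num
  have b1 : pr (fun ω : Ω => ¬ SplitsDegrees E P W t ω.1) ≤
      25 * k ^ 2 * p ^ 3 * Real.exp (18 * k ^ 4 - t) :=
    pr_fst_le (B := fun u => ¬ SplitsDegrees E P W t u)
      ((h.pr_not_splitsDegrees ht).trans (by gcongr))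
  have b2 : pr (fun ω : Ω => SplitsDegrees E P W t ω.1 ∧ ¬ SplitsEdges E P W t ω.1) ≤
      8 * k ^ 2 * p ^ 3 * Real.exp (18 * k ^ 4 - t) :=
    pr_fst_le (B := fun u => SplitsDegrees E P W t u ∧ ¬ SplitsEdges E P W t u)
      ((h.pr_not_splitsEdges ht).trans (by gcongr))
  have b3 : pr (fun ω : Ω => SplitsDegrees E P W t ω.1 ∧ ∃ s ∈ univ,
      t * (t * W) < ∑ θ, if ω.2 θ = s then (lightWeight E P ω.1 θ : ℝ) else 0) ≤
      p * Real.exp (18 * k ^ 4 - t) := by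
    refine pr_prod_le (fun u => ?_) (by positivity)
    by_cases hu : SplitsDegrees E P W t u
    · refine (pr_mono fun G hG => hG.2).trans ((pr_exists_le univ
        (fun s (G : Vertex k n × Vertex k n × Fin k × Fin N → Fin p) =>
          t * (t * W) < ∑ θ, if G θ = s then (lightWeight E P u θ : ℝ) else 0)
        (ε := Real.exp (18 * k ^ 4 - t)) fun s _ => ?_).trans_eq (by simp))
      refine (h.pr_weight_route_le (w := fun θ => (lightWeight E P u θ : ℝ)) (B := t * W)
        (μ := 2 * k ^ 4) (by positivity)
        (fun θ => Nat.cast_nonneg _) (fun θ => ?_) ?_ s).trans ?_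
      · unfold lightWeight
        split_ifs
        · exact hu _ _ _ _ (h.chunks_pos _ _) (h.chunks_le _ _) (h.degree_le _ _)
        · simp; positivity
      · refine (h.sum_lightWeight_le u).trans ?_
        gcongr
        exact le_mul_of_one_le_left (by positivity) ht
      · exact Real.exp_le_exp.2 (by linarith)
    · rw [pr_eq_zero fun G hG => hu hG.1]
      positivity
  have b4 : pr (fun ω : Ω => ∃ s ∈ univ,
      t * W < ∑ θ, if ω.2 θ = s then (heavyWeight E P θ : ℝ) else 0) ≤
      p * Real.exp (18 * k ^ 4 - t) := by
    refine pr_prod_le (fun u => ?_) (by positivity)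
    refine (pr_exists_le univ
      (fun s (G : Vertex k n × Vertex k n × Fin k × Fin N → Fin p) =>
        t * W < ∑ θ, if G θ = s then (heavyWeight E P θ : ℝ) else 0)
      (ε := Real.exp (18 * k ^ 4 - t)) fun s _ => ?_).trans_eq (by simp)
    refine (h.pr_weight_route_le (w := fun θ => (heavyWeight E P θ : ℝ)) (B := W)
      (μ := 9 * k ^ 4) (by positivity)
      (fun θ => Nat.cast_nonneg _) (fun θ => ?_) (h.sum_heavyWeight_le hk) s).trans ?_
    · unfold heavyWeight
      split_ifs <;> simp <;> linarith
    · apply le_of_eq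
      ring_nf
  have hsub : ∀ ω : Ω, ¬ Good E P W t ω → ((¬ SplitsDegrees E P W t ω.1) ∨
      (SplitsDegrees E P W t ω.1 ∧ ¬ SplitsEdges E P W t ω.1)) ∨
      ((SplitsDegrees E P W t ω.1 ∧ ∃ s ∈ univ,
        t * (t * W) < ∑ θ, if ω.2 θ = s then (lightWeight E P ω.1 θ : ℝ) else 0) ∨
      ∃ s ∈ univ, t * W < ∑ θ, if ω.2 θ = s then (heavyWeight E P θ : ℝ) else 0) := by
    intro ω hω
    by_contra hcon
    push Not at hcon
    obtain ⟨⟨h1, h2⟩, h3, h4⟩ := hcon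
    refine hω ⟨h1, h2 h1, fun s => ?_, fun s => ?_⟩
    · refine le_trans ?_ (h3 h1 s (mem_univ s))
      exact_mod_cast card_sendsLight_le ω.1 ω.2 s
    · refine le_trans ?_ (h4 s (mem_univ s))
      exact_mod_cast card_sendsHeavy_le ω.2 s
  refine (pr_mono hsub).trans ?_
  refine (pr_or_le _ _).trans ?_
  have c1 := (pr_or_le _ _).trans (add_le_add b1 b2)
  have c2 := (pr_or_le _ _).trans (add_le_add b3 b4)
  refine (add_le_add c1 c2).trans ?_
  have := mul_le_mul_of_nonneg_right hpp (Real.exp_pos (18 * k ^ 4 - t)).le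
  linarith

end Regular

end CliqueMPC

/-! ### The number of cells -/

namespace CliqueMPC

open Finset

variable {k n p N : ℕ} {E : Finset (Edge k n)} {P : Layout k n} {l W t : ℝ}

open Classical in
/-- The admissible entries of a pattern at the variable `x_i`. -/
noncomputable def entries (P : Layout k n) (i : Fin k) : Finset (Option (Fin n)) :=
  univ.filter fun o => ∀ v, o = some v → P.heavy (i, v)

theorem patterns_eq (P : Layout k n) : P.patterns = Fintype.piFinset (entries P) := by
  classical
  ext η
  simp [Layout.patterns, entries]

open Classical in
theorem sum_entries (P : Layout k n) (i : Fin k) (f : Option (Fin n) → ℕ) :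
    ∑ o ∈ entries P i, f o = f none + ∑ v ∈ univ.filter fun v => P.heavy (i, v), f (some v) := by
  simp [entries, sum_filter, Fintype.sum_option]

/-- The contribution of an entry of a pattern whose only light variable is `x_l` to the number of
buckets that is due to the value of `x_i`. -/
def entryWeight (P : Layout k n) (l i j : Fin k) (o : Option (Fin n)) : ℕ :=
  if j = l then o.elim 1 (fun _ => 0)
  else if j = i then o.elim 0 (fun v => P.chunks (i, v) l)
  else o.elim 0 (fun _ => 1)

/-- The right side is a sum of products over the variables, so its sum over all patterns factorises.
For a single light variable the maximum in `share` is replaced by a sum over the other variables. -/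
theorem prod_bucket_le (P : Layout k n) (η : Fin k → Option (Fin n)) :
    ∏ i, (if η i = none then P.share η else 1) ≤
      ∏ i, (η i).elim P.side (fun _ => 1) +
        ∑ l, ∑ i ∈ univ.erase l, ∏ j, entryWeight P l i j (η j) := by
  classical
  rcases Nat.lt_or_ge (lights η).card 2 with h2 | h2
  · rcases (lights η).eq_empty_or_nonempty with h0 | ⟨l, hl⟩
    · have h0' : ∀ i, ∃ v, η i = some v := fun i => by
        refine Option.ne_none_iff_exists'.1 fun hi => ?_
        have : i ∈ lights η := by simpa [lights] using hi
        simp [h0] at this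
      refine le_add_right (prod_le_prod' fun i _ => ?_)
      obtain ⟨v, hv⟩ := h0' i
      simp [hv]
    · have hl' : η l = none := by simpa [lights] using hl
      have hne : ∀ i, i ≠ l → ∃ v, η i = some v := fun i hi => by
        refine Option.ne_none_iff_exists'.1 fun hi' => ?_
        have : i ∈ lights η := by simpa [lights] using hi'
        exact h2.not_ge (one_lt_card.2 ⟨i, this, l, hl, hi⟩)
      have hprod : ∏ i, (if η i = none then P.share η else 1) = P.share η := by
        rw [prod_eq_single l]
        · simp [hl']
        · intro i _ hi
          obtain ⟨v, hv⟩ := hne i hi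
          simp [hv]
        · simp
      have hlights : lights η = {l} := by
        refine eq_singleton_iff_unique_mem.2 ⟨hl, fun i hi => ?_⟩
        by_contra hil
        exact h2.not_ge (one_lt_card.2 ⟨i, hi, l, hl, hil⟩)
      have hentry : ∀ i ∈ univ.erase l, ∏ j, entryWeight P l i j (η j) =
          (η i).elim 0 fun v => P.chunks (i, v) l := by
        intro i hi
        have hil := (mem_erase.1 hi).1
        rw [prod_eq_single i]
        · simp [entryWeight, hil]
        · intro j _ hj
          by_cases hjl : j = l
          · simp [entryWeight, hjl, hl']
          · obtain ⟨v, hv⟩ := hne j hjl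
            simp [entryWeight, hjl, hj, hv]
        · simp
      rw [hprod]
      refine le_add_left (le_trans ?_ (single_le_sum (f := fun l => ∑ i ∈ univ.erase l,
        ∏ j, entryWeight P l i j (η j)) (fun _ _ => Nat.zero_le _) (mem_univ l)))
      rw [sum_congr rfl hentry]
      unfold Layout.share
      rw [if_neg h2.not_ge, hlights]
      refine Finset.sup_le ?_
      rintro ⟨i, j⟩ hij
      have hj : j = l := (by simpa using hij : l = j).symm
      subst hj
      by_cases hi : i = j
      · simp [hi, hl']
      · exact single_le_sum (f := fun i => (η i).elim 0 fun v => P.chunks (i, v) j)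
          (fun _ _ => Nat.zero_le _) (mem_erase.2 ⟨hi, mem_univ _⟩)
  · refine le_add_right (prod_le_prod' fun i _ => ?_)
    rcases hi : η i with _ | v
    · simp [Layout.share, h2]
    · simp

namespace Regular

variable (h : Regular E P p N l W)
include h

/-- In the main term a variable contributes `Λ` for being light and `1` for each of at most `k Λ`
heavy values. In the term of `l` and `i`, the light `x_l` contributes only `1`, which pays for the
chunks of `x_i`: these sum to at most `k Λ + Λ ^ 2 ≤ ((k + 1) Λ) ^ 2`. -/
theorem card_cells_le (hk : 2 ≤ k) :
    P.cells.card ≤ ((k + 1) * P.side) ^ k + k ^ 2 * ((k + 1) * P.side) ^ k := by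
  classical
  have hs := h.side_pos
  have hH : ∀ i, (univ.filter fun v => P.heavy (i, v)).card ≤ k * P.side := fun i =>
    h.card_heavy_le i _ fun a ha => (mem_filter.1 ha).2
  have hkey : ∀ l, ∀ i ∈ univ.erase l, ∑ η ∈ P.patterns, ∏ j, entryWeight P l i j (η j) ≤
      ((k + 1) * P.side) ^ k := by
    intro l i hi
    have hil := (mem_erase.1 hi).1
    have hli : l ∈ univ.erase i := mem_erase.2 ⟨hil.symm, mem_univ _⟩
    rw [patterns_eq, ← prod_univ_sum]
    simp_rw [sum_entries]
    rw [← mul_prod_erase univ _ (mem_univ i), ← mul_prod_erase _ _ hli]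
    have h1 : (∏ j ∈ (univ.erase i).erase l, (entryWeight P l i j none +
        ∑ v ∈ univ.filter fun v => P.heavy (j, v), entryWeight P l i j (some v))) ≤
        ((k + 1) * P.side) ^ (k - 2) := by
      refine (prod_le_pow_card _ _ ((k + 1) * P.side) fun j hj => ?_).trans_eq ?_
      · simp only [mem_erase] at hj
        simp only [entryWeight, hj.1, hj.2.1, if_false, Option.elim, zero_add, sum_const,
          smul_eq_mul, mul_one]
        exact (hH j).trans (Nat.mul_le_mul_right _ (Nat.le_succ _))
      · rw [card_erase_of_mem hli, card_erase_of_mem (mem_univ i), card_univ, Fintype.card_fin]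
        rfl
    have h2 : entryWeight P l i i none +
        ∑ v ∈ univ.filter (fun v => P.heavy (i, v)), entryWeight P l i i (some v) ≤
        ((k + 1) * P.side) ^ 2 := by
      simp only [entryWeight, hil, if_true, if_false, Option.elim, zero_add]
      refine (h.sum_chunks_le i l _).trans ?_
      have := hH i
      nlinarith [Nat.zero_le k, Nat.zero_le (k * P.side ^ 2), Nat.mul_le_mul_left k hs]
    have h3 : entryWeight P l i l none +
        ∑ v ∈ univ.filter (fun v => P.heavy (l, v)), entryWeight P l i l (some v) = 1 := by
      simp [entryWeight]
    rw [h3, one_mul]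
    calc _ ≤ ((k + 1) * P.side) ^ 2 * ((k + 1) * P.side) ^ (k - 2) := Nat.mul_le_mul h2 h1
      _ = _ := by rw [← pow_add]; congr 1; omega
  calc P.cells.card = ∑ η ∈ P.patterns, ∏ i, (if η i = none then P.share η else 1) := by
        simp [Layout.cells]
    _ ≤ ∑ η ∈ P.patterns, (∏ i, (η i).elim P.side (fun _ => 1) +
        ∑ l, ∑ i ∈ univ.erase l, ∏ j, entryWeight P l i j (η j)) :=
        sum_le_sum fun η _ => prod_bucket_le P η
    _ = (∑ η ∈ P.patterns, ∏ i, (η i).elim P.side (fun _ => 1)) +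
        ∑ l, ∑ i ∈ univ.erase l, ∑ η ∈ P.patterns, ∏ j, entryWeight P l i j (η j) := by
        rw [sum_add_distrib]
        congr 1
        rw [sum_comm]
        exact sum_congr rfl fun l _ => sum_comm
    _ ≤ ((k + 1) * P.side) ^ k + k ^ 2 * ((k + 1) * P.side) ^ k := by
        refine Nat.add_le_add ?_ ?_
        · rw [patterns_eq, ← prod_univ_sum _ (fun i (o : Option (Fin n)) =>
            o.elim P.side (fun _ => 1))]
          simp_rw [sum_entries]
          refine (prod_le_pow_card _ _ ((k + 1) * P.side) fun i _ => ?_).trans_eq (by simp)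
          simp only [Option.elim, sum_const, smul_eq_mul, mul_one]
          have := hH i
          linarith
        · calc _ ≤ ∑ l : Fin k, ∑ i ∈ univ.erase l, ((k + 1) * P.side) ^ k :=
                sum_le_sum fun l _ => sum_le_sum fun i hi => hkey l i hi
            _ ≤ ∑ l : Fin k, ∑ i : Fin k, ((k + 1) * P.side) ^ k :=
                sum_le_sum fun l _ => sum_le_sum_of_subset (erase_subset _ _)
            _ = _ := by simp; ring

/-- Every server is responsible for a bounded number of cells. -/
theorem card_place_le (hk : 2 ≤ k) [NeZero p] (s : Fin p) :
    open Classical in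
    ((P.cells.filter fun β => P.place p β = s).card : ℝ) ≤
      (1 + k ^ 2) * (2 * (k + 1)) ^ k + 1 := by
  classical
  have hp : (0 : ℝ) < p := by exact_mod_cast h.one_le_servers
  have hl := h.one_le_root
  have h1 : ((P.cells.filter fun β => P.place p β = s).card : ℝ) ≤
      ((P.cells.card / p : ℕ) : ℝ) + 1 := by
    exact_mod_cast card_balanced_le P.cells p s
  have h2 : (P.cells.card : ℝ) ≤ (1 + k ^ 2) * (2 * (k + 1)) ^ k * p := by
    calc (P.cells.card : ℝ) ≤ ((k + 1) * P.side) ^ k + k ^ 2 * ((k + 1) * P.side) ^ k := by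
          exact_mod_cast h.card_cells_le hk
      _ = (1 + k ^ 2) * ((k + 1) * P.side) ^ k := by ring
      _ ≤ (1 + k ^ 2) * ((k + 1) * (2 * l)) ^ k := by gcongr; exact h.side_le_root
      _ = (1 + k ^ 2) * (2 * (k + 1)) ^ k * l ^ k := by
          rw [mul_assoc, ← mul_pow]
          ring
      _ = _ := by rw [h.root_pow_eq]
  refine h1.trans (add_le_add_left (Nat.cast_div_le.trans ((div_le_iff₀ hp).2 h2)) 1)

end Regular

end CliqueMPC

/-! ### The load of the last two rounds -/

namespace CliqueMPC

open Finset

variable {k n p N : ℕ} {E : Finset (Edge k n)} {P : Layout k n} {l W t : ℝ}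

theorem sum_card_filter_le {α ι : Type*} [DecidableEq α] [Fintype ι] {E : Finset α} {D : ι → Finset α}
    (hDE : ∀ s, D s ⊆ E) (hD : ∀ e s s', e ∈ D s → e ∈ D s' → s = s') (Q : α → Prop)
    [DecidablePred Q] :
    ∑ s, ((D s).filter Q).card ≤ (E.filter Q).card := by
  rw [← card_biUnion]
  · exact card_le_card (biUnion_subset.2 fun s _ => filter_subset_filter _ (hDE s))
  · intro s _ s' _ hs
    refine disjoint_left.2 fun e he he' => hs (hD e s s' ?_ ?_)
    · exact (mem_filter.1 he).1
    · exact (mem_filter.1 he').1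

open Classical in
/-- The edges that belong to the cell `β` and are sent directly to its server. -/
noncomputable def cellEdges (E : Finset (Edge k n)) (P : Layout k n) (u : Fin k → Fin n → Fin N)
    (β : Cell k n) : Finset (Edge k n) :=
  E.filter fun e => P.Fits u β e.1 ∧ P.Fits u β e.2 ∧
    ((P.heavy e.1 ↔ P.heavy e.2) ∨ (P.heavy e.1 ∧ ¬ P.heavy e.2 ∧ (lights β.1).card ≤ 1))

theorem card_heavy_light_le (u : Fin k → Fin n → Fin N) (x : Vertex k n) (j : Fin k) (c r : ℕ)
    (F : Finset (Edge k n)) (hF : ∀ e ∈ F, e ∈ E ∧ e.1 = x ∧ e.2.1 = j ∧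
      ¬ P.heavy e.2 ∧ (u j e.2.2 : ℕ) % c = r) :
    F.card ≤ residueCount E P u x j c r := by
  refine card_le_card_of_injOn (fun e => e.2.2) ?_ ?_
  · rintro ⟨y, ⟨j', b⟩⟩ he
    obtain ⟨h1, rfl, rfl, h3, h4⟩ := hF _ he
    simp only [coe_filter, mem_univ, true_and]
    exact ⟨h1, h3, h4⟩
  · rintro ⟨y, ⟨j', b⟩⟩ he ⟨y', ⟨j'', b'⟩⟩ he' hbb
    obtain ⟨-, rfl, rfl, -⟩ := hF _ he
    obtain ⟨-, h1, h2, -⟩ := hF _ he'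
    simp only at h1 h2 hbb
    rw [h1, h2, hbb]

namespace Regular

variable (h : Regular E P p N l W)
include h

theorem card_light_le (u : Fin k → Fin n → Fin N) (i j : Fin k) (r r' : ℕ)
    (F : Finset (Edge k n)) (hF : ∀ e ∈ F, e ∈ E ∧ e.1.1 = i ∧ e.2.1 = j ∧ ¬ P.heavy e.1 ∧
      ¬ P.heavy e.2 ∧ (u i e.1.2 : ℕ) % P.side = r ∧ (u j e.2.2 : ℕ) % P.side = r') :
    F.card ≤ bucketCount E P u i j r r' := by
  classical
  set T := (univ.filter fun b => (u j b : ℕ) % P.side = r' ∧ ¬ P.heavy (j, b)).sigma fun b =>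
    univ.filter fun a => ((j, b), (i, a)) ∈ E ∧ ¬ P.heavy (i, a) ∧ (u i a : ℕ) % P.side = r with hT
  have h1 : F ⊆ T.image fun y => ((i, y.2), (j, y.1)) := by
    rintro ⟨⟨i', a⟩, ⟨j', b⟩⟩ he
    obtain ⟨h1, rfl, rfl, h2, h3, h4, h5⟩ := hF _ he
    refine mem_image.2 ⟨⟨b, a⟩, ?_, rfl⟩
    simp only [hT, mem_sigma, mem_filter, mem_univ, true_and]
    exact ⟨⟨h5, h3⟩, h.symm _ _ h1, h2, h4⟩
  refine (card_le_card h1).trans (card_image_le.trans ?_)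
  rw [hT, card_sigma, sum_filter]
  refine sum_le_sum fun b _ => ?_
  unfold residueCount
  by_cases h1 : (u j b : ℕ) % P.side = r' <;> by_cases h2 : P.heavy (j, b) <;> simp [h1, h2]

/-- The pattern decides which endpoints are heavy. Two light endpoints give a bucket count; from
heavy to light, the share is at least the number of chunks, so one residue class is small; two heavy
endpoints leave at most one edge; from light to heavy nothing is sent. -/
theorem card_cellEdges_between_le (ht : 1 ≤ t) {u : Fin k → Fin n → Fin N}
    (hdeg : SplitsDegrees E P W t u) (hedge : SplitsEdges E P W t u) (β : Cell k n)
    (i j : Fin k) :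
    (((cellEdges E P u β).filter fun e => e.1.1 = i ∧ e.2.1 = j).card : ℝ) ≤ t * (t * W) := by
  classical
  have hW := h.one_le_bound
  have htW : 1 ≤ t * W := by nlinarith
  have httW : t * W ≤ t * (t * W) := le_mul_of_one_le_left (by linarith) ht
  set F := (cellEdges E P u β).filter fun e => e.1.1 = i ∧ e.2.1 = j with hF
  have hmem : ∀ e ∈ F, e ∈ E ∧ P.Fits u β e.1 ∧ P.Fits u β e.2 ∧
      ((P.heavy e.1 ↔ P.heavy e.2) ∨ (P.heavy e.1 ∧ ¬ P.heavy e.2 ∧ (lights β.1).card ≤ 1)) ∧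
      e.1.1 = i ∧ e.2.1 = j := by
    intro e he
    obtain ⟨he, h1⟩ := mem_filter.1 he
    obtain ⟨he, h2, h3, h4⟩ := mem_filter.1 he
    exact ⟨he, h2, h3, h4, h1⟩
  rcases F.eq_empty_or_nonempty with h0 | ⟨e₀, he₀⟩
  · simp only [h0, card_empty, Nat.cast_zero]
    linarith
  obtain ⟨h0E, h0x, h0y, h0, rfl, rfl⟩ := hmem e₀ he₀
  have hij : e₀.1.1 ≠ e₀.2.1 := h.ne _ _ h0E
  have heavy_of : ∀ x v, P.Fits u β x → β.1 x.1 = some v → P.heavy x ∧ x.2 = v := by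
    rintro x v (⟨hx, hv⟩ | ⟨-, hx, -⟩) hv'
    · exact ⟨hx, Option.some.inj (hv.symm.trans hv')⟩
    · rw [hx] at hv'; exact absurd hv' (by simp)
  have light_of : ∀ x, P.Fits u β x → β.1 x.1 = none → ¬ P.heavy x ∧
      (u x.1 x.2 : ℕ) % P.share β.1 = β.2 x.1 := by
    rintro x (⟨-, hv⟩ | ⟨hx, -, hx'⟩) hv'
    · rw [hv] at hv'; exact absurd hv' (by simp)
    · exact ⟨hx, hx'⟩
  rcases hi : β.1 e₀.1.1 with _ | v <;> rcases hj : β.1 e₀.2.1 with _ | v'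
  · have h2 : 2 ≤ (lights β.1).card :=
      one_lt_card.2 ⟨e₀.1.1, by simpa [lights] using hi, e₀.2.1, by simpa [lights] using hj, hij⟩
    have hshare : P.share β.1 = P.side := if_pos h2
    refine le_trans ?_ (hedge e₀.1.1 e₀.2.1 (β.2 e₀.1.1) (β.2 e₀.2.1) hij)
    refine Nat.cast_le.2 (h.card_light_le u _ _ _ _ F fun e he => ?_)
    obtain ⟨hE, hx, hy, -, hxi, hyj⟩ := hmem e he
    obtain ⟨hx1, hx2⟩ := light_of _ hx (hxi ▸ hi)
    obtain ⟨hy1, hy2⟩ := light_of _ hy (hyj ▸ hj)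
    rw [hxi, hshare] at hx2
    rw [hyj, hshare] at hy2
    exact ⟨hE, hxi, hyj, hx1, hy1, hx2, hy2⟩
  · have h1 := (light_of _ h0x hi).1
    have h2 := (heavy_of _ _ h0y hj).1
    tauto
  · have h1 := (heavy_of _ _ h0x hi).1
    have h2 := (light_of _ h0y hj).1
    have h3 : (lights β.1).card ≤ 1 := by tauto
    have hc : P.chunks (e₀.1.1, v) e₀.2.1 ≤ P.share β.1 := by
      unfold Layout.share
      rw [if_neg (by omega)]
      have := le_sup (s := univ ×ˢ lights β.1)
        (f := fun x => (β.1 x.1).elim 0 fun v => P.chunks (x.1, v) x.2) (b := (e₀.1.1, e₀.2.1))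
        (by simp [lights, hj])
      simpa [hi] using this
    have hcN : P.share β.1 ≤ N := by
      unfold Layout.share
      rw [if_neg (by omega)]
      refine Finset.sup_le fun x _ => ?_
      rcases β.1 x.1 with _ | v
      · exact Nat.zero_le _
      · exact h.chunks_le _ _
    refine le_trans ?_ ((hdeg (e₀.1.1, v) e₀.2.1 (P.share β.1) (β.2 e₀.2.1)
      ((h.chunks_pos _ _).trans_le hc) hcN ((h.degree_le _ _).trans (by gcongr))).trans httW)
    refine Nat.cast_le.2 (card_heavy_light_le u _ _ _ _ F fun e he => ?_)
    obtain ⟨hE, hx, hy, -, hxi, hyj⟩ := hmem e he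
    obtain ⟨hy1, hy2⟩ := light_of _ hy (hyj ▸ hj)
    rw [hyj] at hy2
    exact ⟨hE, Prod.ext hxi (heavy_of _ _ hx (hxi ▸ hi)).2, hyj, hy1, hy2⟩
  · have h1 : F.card ≤ 1 := by
      refine card_le_one.2 fun e he e' he' => ?_
      obtain ⟨-, hx, hy, -, hxi, hyj⟩ := hmem e he
      obtain ⟨-, hx', hy', -, hxi', hyj'⟩ := hmem e' he'
      refine Prod.ext (Prod.ext (hxi.trans hxi'.symm) ?_) (Prod.ext (hyj.trans hyj'.symm) ?_)
      · exact (heavy_of _ _ hx (hxi ▸ hi)).2.trans (heavy_of _ _ hx' (hxi' ▸ hi)).2.symm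
      · exact (heavy_of _ _ hy (hyj ▸ hj)).2.trans (heavy_of _ _ hy' (hyj' ▸ hj)).2.symm
    have h1' : (F.card : ℝ) ≤ 1 := by exact_mod_cast h1
    linarith

theorem card_cellEdges_le (ht : 1 ≤ t) {u : Fin k → Fin n → Fin N}
    (hdeg : SplitsDegrees E P W t u) (hedge : SplitsEdges E P W t u) (β : Cell k n) :
    ((cellEdges E P u β).card : ℝ) ≤ k ^ 2 * (t * (t * W)) := by
  classical
  have h1 : (cellEdges E P u β).card = ∑ y : Fin k × Fin k,
      ((cellEdges E P u β).filter fun e => e.1.1 = y.1 ∧ e.2.1 = y.2).card := by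
    rw [card_eq_sum_card_fiberwise (f := fun e => (e.1.1, e.2.1)) (t := univ) (by simp)]
    simp only [Prod.ext_iff]
  rw [h1]
  push_cast
  refine (sum_le_sum fun y _ => h.card_cellEdges_between_le ht hdeg hedge β y.1 y.2).trans_eq ?_
  rw [sum_const, card_univ, Fintype.card_prod, Fintype.card_fin, nsmul_eq_mul]
  push_cast
  ring

variable {u : Fin k → Fin n → Fin N}
  {G : Vertex k n × Vertex k n × Fin k × Fin N → Fin p} {D : Fin p → Finset (Edge k n)}

theorem semijoin_load_le (hgood : Good E P W t (u, G)) (ht : 1 ≤ t) (hDE : ∀ s, D s ⊆ E)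
    (hD : ∀ e s s', e ∈ D s → e ∈ D s' → s = s') (s : Fin p) :
    ((∑ s', (P.semijoinMsg u G (D s') s).card : ℕ) : ℝ) ≤ 2 * (t * (t * W)) := by
  classical
  have hW := h.one_le_bound
  have h1 : ∑ s', (P.semijoinMsg u G (D s') s).card ≤
      (E.filter (P.SendsHeavy G s)).card + (E.filter (P.SendsLight u G s)).card := by
    unfold Layout.semijoinMsg
    refine (sum_card_filter_le hDE hD _).trans ?_
    rw [filter_or]
    exact card_union_le _ _
  have h2 := hgood.2.2.1 s
  have h3 := hgood.2.2.2 s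
  have httW : t * W ≤ t * (t * W) := le_mul_of_one_le_left (by positivity) ht
  have h1' : ((∑ s', (P.semijoinMsg u G (D s') s).card : ℕ) : ℝ) ≤
      (E.filter (P.SendsHeavy G s)).card + (E.filter (P.SendsLight u G s)).card := by
    exact_mod_cast h1
  linarith

theorem final_load_le [NeZero p] (hgood : Good E P W t (u, G)) (hk : 2 ≤ k) (ht : 1 ≤ t)
    (hDE : ∀ s, D s ⊆ E) (hD : ∀ e s s', e ∈ D s → e ∈ D s' → s = s')
    {K : Fin p → Finset (Edge k n)} (hK : ∀ s, K s ⊆ E) (s : Fin p) :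
    ((∑ s', (P.finalMsg u G (D s') (K s') s' s).card : ℕ) : ℝ) ≤
      ((1 + k ^ 2) * (2 * (k + 1)) ^ k + 1) * ((k + 1) * (k ^ 2 * (t * (t * W)))) := by
  classical
  have hW := h.one_le_bound
  set C := P.cells.filter fun β => P.place p β = s with hC
  have hdirect : ∑ s', ((D s').filter (P.SendsDirect u s)).card ≤
      ∑ β ∈ C, (cellEdges E P u β).card := by
    refine (sum_card_filter_le hDE hD _).trans (le_trans (card_le_card ?_) card_biUnion_le)
    intro e he
    obtain ⟨he, β, hβ, hs, h1, h2, h3⟩ := mem_filter.1 he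
    exact mem_biUnion.2 ⟨β, mem_filter.2 ⟨hβ, hs⟩, mem_filter.2 ⟨he, h1, h2, h3⟩⟩
  have hrelay : ∑ s', ((K s').filter (P.Relays u G (K s') s' s)).card ≤
      ∑ β ∈ C, k * (cellEdges E P u β).card := by
    -- A relayed edge `(x, y)` and its sender are recovered from the cell, the variable of `x` and
    -- the light edge `(y, z)`: the pattern prescribes the value of `x`, and `G` names the sender.
    -- The default of `getD` is a dummy.
    let f : (Σ _ : Cell k n, Fin k × Edge k n) → (Σ _ : Fin p, Edge k n) := fun y =>
      ⟨G ((y.2.1, (y.1.1 y.2.1).getD y.2.2.1.2), y.2.2.1, y.2.2.2.1, P.chunk u y.2.2.1 y.2.2.2),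
        ((y.2.1, (y.1.1 y.2.1).getD y.2.2.1.2), y.2.2.1)⟩
    have hsub : (univ.sigma fun s' => (K s').filter (P.Relays u G (K s') s' s)) ⊆
        (C.sigma fun β => univ ×ˢ cellEdges E P u β).image f := by
      rintro ⟨s', ⟨x, y⟩⟩ he
      simp only [mem_sigma, mem_univ, true_and] at he
      obtain ⟨-, hx, hy, z, hz, hyz, hs', β, hβ, hs, -, hfx, hfy, hfz⟩ := mem_filter.1 he
      refine mem_image.2 ⟨⟨β, (x.1, (y, z))⟩, ?_, ?_⟩
      · simp only [mem_sigma, mem_product, mem_univ, true_and]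
        refine ⟨mem_filter.2 ⟨hβ, hs⟩, mem_filter.2 ⟨hK _ hyz, hfy, hfz, Or.inl ?_⟩⟩
        exact ⟨fun h => absurd h hy, fun h => absurd h hz⟩
      · have hβx : β.1 x.1 = some x.2 := by
          rcases hfx with hfx | hfx
          · exact hfx.2
          · exact absurd hx hfx.1
        simp only [f, hβx, Option.getD_some]
        rw [← hs']
    rw [← card_sigma]
    refine (card_le_card hsub).trans (card_image_le.trans_eq ?_)
    rw [card_sigma]
    simp
  have hB := h.card_place_le hk s
  have hcell := h.card_cellEdges_le ht hgood.1 hgood.2.1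
  have h1 : ∑ s', (P.finalMsg u G (D s') (K s') s' s).card ≤
      ∑ β ∈ C, (k + 1) * (cellEdges E P u β).card := by
    refine (sum_le_sum fun s' _ => card_union_le _ _).trans ?_
    rw [sum_add_distrib]
    refine (Nat.add_le_add hdirect hrelay).trans_eq ?_
    rw [← sum_add_distrib]
    exact sum_congr rfl fun β _ => by ring
  calc ((∑ s', (P.finalMsg u G (D s') (K s') s' s).card : ℕ) : ℝ)
      ≤ ∑ β ∈ C, ((k + 1) * (cellEdges E P u β).card : ℝ) := by exact_mod_cast h1
    _ ≤ ∑ β ∈ C, ((k + 1) * (k ^ 2 * (t * (t * W))) : ℝ) := by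
        gcongr with β
        exact hcell β
    _ = C.card * ((k + 1) * (k ^ 2 * (t * (t * W)))) := by simp
    _ ≤ _ := by gcongr

end Regular

end CliqueMPC

/-! ### The layout derived from the heavy-hitter statistics -/

namespace CliqueMPC

open Finset

variable {k n p : ℕ}

theorem degree_eq_freq_zero (I : (ConjQuery.clique k).Instance n) (x : Vertex k n) {j : Fin k}
    (h : x.1 < j) : degree (edges I) x j =
      (ConjQuery.clique k).freq I ⟨(x.1, j), h⟩ (0 : Fin 2) x.2 := by
  classical
  refine card_bij' (fun b _ => (![x.2, b] : Fin 2 → Fin n)) (fun t _ => t (1 : Fin 2)) ?_ ?_ ?_ ?_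
  · intro b hb
    simpa [edges, Adj, h] using hb
  · intro t ht
    obtain ⟨h1, h2⟩ := mem_filter.1 ht
    have : (![x.2, t (1 : Fin 2)] : Fin 2 → Fin n) = t := by
      funext a
      fin_cases a
      · exact h2.symm
      · rfl
    simpa [edges, Adj, h, this] using h1
  · intro b _
    rfl
  · intro t ht
    funext a
    fin_cases a
    · exact (mem_filter.1 ht).2.symm
    · rfl

theorem degree_eq_freq_one (I : (ConjQuery.clique k).Instance n) (x : Vertex k n) {j : Fin k}
    (h : j < x.1) : degree (edges I) x j =
      (ConjQuery.clique k).freq I ⟨(j, x.1), h⟩ (1 : Fin 2) x.2 := by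
  classical
  refine card_bij' (fun b _ => (![b, x.2] : Fin 2 → Fin n)) (fun t _ => t (0 : Fin 2)) ?_ ?_ ?_ ?_
  · intro b hb
    simpa [edges, Adj, h, h.not_gt] using hb
  · intro t ht
    obtain ⟨h1, h2⟩ := mem_filter.1 ht
    have : (![t (0 : Fin 2), x.2] : Fin 2 → Fin n) = t := by
      funext a
      fin_cases a
      · rfl
      · exact h2.symm
    simpa [edges, Adj, h, h.not_gt, this] using h1
  · intro b _
    rfl
  · intro t ht
    funext a
    fin_cases a
    · rfl
    · exact (mem_filter.1 ht).2.symm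

theorem degree_self (I : (ConjQuery.clique k).Instance n) (x : Vertex k n) :
    degree (edges I) x x.1 = 0 := by
  classical
  simp [degree, edges, Adj]

theorem sum_freq (I : (ConjQuery.clique k).Instance n) (e : (ConjQuery.clique k).Atom)
    (a : Fin 2) : ∑ v, (ConjQuery.clique k).freq I e a v = (I e).card :=
  (card_eq_sum_card_fiberwise (f := fun t : Fin 2 → Fin n => t a) (t := univ)
    (fun _ _ => mem_coe.2 (mem_univ _))).symm

variable {m : ℕ} {I : (ConjQuery.clique k).Instance n}

theorem sum_degree_edges_le (hI : ∀ e, (I e).card = m) (i j : Fin k) :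
    ∑ a, degree (edges I) (i, a) j ≤ m := by
  rcases lt_trichotomy i j with h | rfl | h
  · simp_rw [degree_eq_freq_zero I (i, _) h]
    exact (sum_freq I _ 0).le.trans (hI _).le
  · simp [degree_self I (i, _)]
  · simp_rw [degree_eq_freq_one I (i, _) h]
    exact (sum_freq I _ 1).le.trans (hI _).le

theorem degree_edges_le (hI : ∀ e, (I e).card = m) (x : Vertex k n) (j : Fin k) :
    degree (edges I) x j ≤ m :=
  (single_le_sum (f := fun a => degree (edges I) (x.1, a) j) (fun _ _ => Nat.zero_le _)
    (mem_univ x.2)).trans (sum_degree_edges_le hI x.1 j)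

/-- The servers know the degree of a vertex, or else it is small. -/
theorem degreeStat_cases (hI : ∀ e, (I e).card = m) (x : Vertex k n) (j : Fin k) :
    degreeStat ((ConjQuery.clique k).heavyHitters p I) x j = some (degree (edges I) x j) ∨
      (degreeStat ((ConjQuery.clique k).heavyHitters p I) x j = none ∧
        p * degree (edges I) x j ≤ m) := by
  rcases lt_trichotomy x.1 j with h | rfl | h
  · rw [degree_eq_freq_zero I x h]
    simp only [degreeStat, h, dite_true, ConjQuery.heavyHitters, hI]
    split_ifs with h1
    · exact Or.inl rfl
    · exact Or.inr ⟨rfl, (not_le.1 h1).le⟩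
  · simp [degreeStat, degree_self]
  · rw [degree_eq_freq_one I x h]
    simp only [degreeStat, h, h.not_gt, dite_true, dite_false, ConjQuery.heavyHitters, hI]
    split_ifs with h1
    · exact Or.inl rfl
    · exact Or.inr ⟨rfl, (not_le.1 h1).le⟩

/-- A degree absent from the statistics is at most `m / p ≤ W`, so treating it as light and not
cutting it is harmless. The other bounds follow because the degrees from one variable to another sum
to at most `m`. -/
theorem regular_layout (hk : 3 ≤ k) (hp : 1 ≤ p) (hm : (p : ℝ) ^ (2 / k : ℝ) ≤ m)
    (hI : ∀ e, (I e).card = m) :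
    Regular (edges I) (layout ⌈(p : ℝ) ^ (1 / k : ℝ)⌉₊ m ((ConjQuery.clique k).heavyHitters p I))
      p (⌈(p : ℝ) ^ (1 / k : ℝ)⌉₊ ^ 2 + 1) ((p : ℝ) ^ (1 / k : ℝ)) (m / (p : ℝ) ^ (2 / k : ℝ)) := by
  classical
  have hp' : (1 : ℝ) ≤ p := by exact_mod_cast hp
  have hk0 : (k : ℝ) ≠ 0 := by norm_cast; omega
  have hsq : (p : ℝ) ^ (2 / k : ℝ) = ((p : ℝ) ^ (1 / k : ℝ)) ^ 2 := by
    rw [← Real.rpow_mul_natCast (by linarith)]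
    congr 1
    push_cast
    ring
  have hpow : ((p : ℝ) ^ (1 / k : ℝ)) ^ k = p := by
    rw [← Real.rpow_mul_natCast (by linarith), one_div, inv_mul_cancel₀ hk0, Real.rpow_one]
  have hl : 1 ≤ (p : ℝ) ^ (1 / k : ℝ) := Real.one_le_rpow hp' (by positivity)
  rw [hsq] at hm ⊢
  set l := (p : ℝ) ^ (1 / k : ℝ)
  set Λ := ⌈l⌉₊
  have hl0 : 0 < l := by linarith
  have hlΛ : l ≤ Λ := Nat.le_ceil l
  have hΛl : (Λ : ℝ) ≤ 2 * l := by
    have := Nat.ceil_lt_add_one hl0.le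
    linarith
  -- Here `k ≥ 3` enters: it pays for the replication in the semijoin round.
  have hcube : l ^ 3 ≤ p := (pow_le_pow_right₀ hl hk).trans_eq hpow
  have hlsq : l ^ 2 ≤ p := (pow_le_pow_right₀ hl (by norm_num)).trans hcube
  have hm0 : (0 : ℝ) < m := lt_of_lt_of_le (by positivity) hm
  have hm0' : 0 < m := by exact_mod_cast hm0
  have hsmall : ∀ d : ℕ, p * d ≤ m → (d : ℝ) ≤ m / l ^ 2 := by
    intro d hd
    rw [le_div_iff₀ (by positivity)]
    have : (p * d : ℝ) ≤ m := by exact_mod_cast hd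
    nlinarith [Nat.cast_nonneg (α := ℝ) d]
  have hlW : m / l ^ 2 ≤ l * (m / l ^ 2) := le_mul_of_one_le_left (by positivity) hl
  refine
    { one_le_bound := (one_le_div (by positivity)).2 hm
      one_le_root := hl
      root_pow_eq := hpow
      root_cube_le := hcube
      root_le_side := hlΛ
      side_le_root := hΛl
      side_le_range := ?_
      range_le := ?_
      symm := fun x y => (mem_edges_comm I).1
      ne := ?_
      sum_degree_le := ?_
      degree_le_of_light := ?_
      card_heavy_le := ?_
      degree_le := ?_
      chunks_pos := chunks_layout_pos Λ m _
      chunks_le := ?_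
      sum_chunks_le := ?_ }
  · exact (Nat.le_self_pow two_ne_zero Λ).trans (Nat.le_succ _)
  · push_cast
    have : (Λ : ℝ) ^ 2 ≤ (2 * l) ^ 2 := by gcongr
    nlinarith
  · intro x y hxy hne
    simp [edges, Adj, hne] at hxy
  · intro i j
    rw [mul_div_cancel₀ _ (by positivity)]
    exact_mod_cast sum_degree_edges_le hI i j
  · intro x j hx
    rcases degreeStat_cases (p := p) hI x j with h1 | ⟨-, h1⟩
    · have h2 : degree (edges I) x j * Λ ≤ m := by
        by_contra h2
        exact hx ⟨j, _, h1, not_le.1 h2⟩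
      have h3 : (degree (edges I) x j * Λ : ℝ) ≤ m := by exact_mod_cast h2
      have h4 : l * (m / l ^ 2) = m / l := by field_simp
      rw [h4, le_div_iff₀ hl0]
      exact le_trans (by gcongr) h3
    · exact (hsmall _ h1).trans hlW
  · intro i A hA
    have hsub : A ⊆ univ.biUnion fun j => A.filter fun a => m < degree (edges I) (i, a) j * Λ := by
      intro a ha
      obtain ⟨j, f, hf, hlt⟩ := hA a ha
      refine mem_biUnion.2 ⟨j, mem_univ _, mem_filter.2 ⟨ha, ?_⟩⟩
      rcases degreeStat_cases (p := p) hI (i, a) j with h1 | ⟨h1, -⟩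
      · rw [h1] at hf
        rwa [Option.some.inj hf]
      · rw [h1] at hf
        exact absurd hf (by simp)
    refine (card_le_card hsub).trans (card_biUnion_le.trans ?_)
    calc _ ≤ ∑ _j : Fin k, Λ := by
          refine sum_le_sum fun j _ => ?_
          refine Nat.le_of_mul_le_mul_right ?_ hm0'
          calc _ = ∑ a ∈ A.filter fun a => m < degree (edges I) (i, a) j * Λ, m := by simp
            _ ≤ ∑ a ∈ A.filter fun a => m < degree (edges I) (i, a) j * Λ,
                  degree (edges I) (i, a) j * Λ :=
                sum_le_sum fun a ha => (mem_filter.1 ha).2.le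
            _ ≤ ∑ a, degree (edges I) (i, a) j * Λ := sum_le_sum_of_subset (subset_univ _)
            _ ≤ Λ * m := by
                rw [← sum_mul, mul_comm]
                exact Nat.mul_le_mul_left _ (sum_degree_edges_le hI i j)
      _ = _ := by simp [layout]
  · intro x j
    rcases degreeStat_cases (p := p) hI x j with h1 | ⟨h1, h2⟩
    · simp only [layout, h1, Option.elim]
      have h3 : (degree (edges I) x j * Λ ^ 2 : ℝ) ≤
          ((degree (edges I) x j * Λ ^ 2 / m + 1 : ℕ) : ℝ) * m := by
        have := Nat.lt_div_mul_add (a := degree (edges I) x j * Λ ^ 2) hm0'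
        have h4 : degree (edges I) x j * Λ ^ 2 ≤ (degree (edges I) x j * Λ ^ 2 / m + 1) * m := by
          rw [add_mul, one_mul]
          exact this.le
        exact_mod_cast h4
      rw [mul_div_assoc', le_div_iff₀ (by positivity)]
      exact le_trans (by gcongr) h3
    · simpa [layout, h1] using hsmall _ h2
  · intro x j
    refine Nat.succ_le_succ ?_
    rcases degreeStat_cases (p := p) hI x j with h1 | ⟨h1, -⟩
    · simp only [h1, Option.elim]
      refine Nat.div_le_of_le_mul ?_
      exact Nat.mul_le_mul_right _ (degree_edges_le hI x j)
    · simp [h1]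
  · intro i j A
    simp only [layout]
    rw [sum_add_distrib, sum_const, smul_eq_mul, mul_one, add_comm]
    refine Nat.add_le_add_left ?_ _
    refine Nat.le_of_mul_le_mul_left ?_ hm0'
    rw [mul_sum]
    calc _ ≤ ∑ a ∈ A, degree (edges I) (i, a) j * Λ ^ 2 := by
          refine sum_le_sum fun a _ => ?_
          rcases degreeStat_cases (p := p) hI (i, a) j with h1 | ⟨h1, -⟩
          · simp only [h1, Option.elim]
            exact Nat.mul_div_le _ _
          · simp [h1]
      _ ≤ ∑ a, degree (edges I) (i, a) j * Λ ^ 2 := sum_le_sum_of_subset (subset_univ _)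
      _ ≤ _ := by
          rw [← sum_mul]
          exact Nat.mul_le_mul_right _ (sum_degree_edges_le hI i j)

/-! ### The load of the algorithm -/

theorem prob_eq_pr {Input Stat Out : Type} (A : MPCAlgorithm Input Stat Out p) [Fintype A.Seed]
    (B : A.Seed → Prop) : A.prob B = pr B := by
  classical
  rw [MPCAlgorithm.prob, pr_def, Nat.card_eq_fintype_card, Nat.card_eq_fintype_card,
    Fintype.card_subtype]

/-- An edge has `(k n) ^ 2` possible values; as `n ≥ 2`, `logb 2 n ≥ 1` absorbs the terms without
`n`. -/
theorem edge_bits_le (hk : 1 ≤ k) (hn : 2 ≤ n) :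
    ((Nat.clog 2 (Fintype.card (Edge k n)) + 1 : ℕ) : ℝ) ≤ (2 * k + 4) * Real.logb 2 n := by
  have hk' : (0 : ℝ) < k := by exact_mod_cast hk
  have hn' : (2 : ℝ) ≤ n := by exact_mod_cast hn
  have h1 : 1 ≤ Real.logb 2 n := by
    rw [Real.le_logb_iff_rpow_le one_lt_two (by linarith)]
    simpa using hn'
  have h2 : Real.logb 2 k ≤ k := by
    rw [Real.logb_le_iff_le_rpow one_lt_two hk', Real.rpow_natCast]
    exact_mod_cast (Nat.lt_two_pow_self (n := k)).le
  have h3 : (Fintype.card (Edge k n) : ℝ) = (k * n : ℝ) ^ 2 := by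
    simp [sq]
  have h4 : Real.logb 2 (Fintype.card (Edge k n)) = 2 * (Real.logb 2 k + Real.logb 2 n) := by
    rw [h3, Real.logb_pow, Real.logb_mul hk'.ne' (by linarith)]
    norm_num
  have h5 : (Nat.clog 2 (Fintype.card (Edge k n)) : ℝ) ≤
      Real.logb 2 (Fintype.card (Edge k n)) + 1 := by
    rw [← Real.natCeil_logb_natCast]
    refine (Nat.ceil_lt_add_one ?_).le
    push_cast
    rw [h4]
    have : 0 ≤ Real.logb 2 k := Real.logb_nonneg one_lt_two (by exact_mod_cast hk)
    linarith
  push_cast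
  rw [h4] at h5
  nlinarith

/-- A bound, up to the factor `t ^ 2`, for the number of edges that a server receives in units of
`m / p ^ (2 / k)`. -/
noncomputable def edgeFactor (k : ℕ) : ℝ :=
  2 + ((1 + k ^ 2) * (2 * (k + 1)) ^ k + 1) * ((k + 1) * k ^ 2)

theorem maxLoad_cliqueAlgorithm_le [NeZero p] {Λ : ℕ} {l W t : ℝ} (hk : 3 ≤ k) (ht : 1 ≤ t)
    {stat : (ConjQuery.clique k).Stats n}
    (h : Regular (edges I) (layout Λ m stat) p (Λ ^ 2 + 1) l W)
    (π : (ConjQuery.clique k).Placement n p) (ω : (cliqueAlgorithm k n p m Λ).Seed)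
    (hgood : Good (edges I) (layout Λ m stat) W t ω) :
    ((cliqueAlgorithm k n p m Λ).maxLoad stat ω ((ConjQuery.clique k).localPart I π) (k - 1) : ℝ) ≤
      edgeFactor k * (t * (t * W)) * (Nat.clog 2 (Fintype.card (Edge k n)) + 1 : ℕ) := by
  have hW := h.one_le_bound
  have hnn : 0 ≤ edgeFactor k * (t * (t * W)) * (Nat.clog 2 (Fintype.card (Edge k n)) + 1 : ℕ) := by
    unfold edgeFactor
    positivity
  -- The load is a supremum in `ℕ`, so the real bound is replaced by its floor.
  rw [← Nat.le_floor_iff hnn]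
  refine Finset.sup_le ?_
  rintro ⟨r, s⟩ -
  rw [Nat.le_floor_iff hnn, received_eq _ _ _ hk, Nat.cast_mul]
  gcongr
  have h1 := h.semijoin_load_le hgood ht (edges_localPart_subset I π)
    (fun e s s' => eq_of_mem_edges_localPart I π) s
  have h2 := h.final_load_le hgood (by omega) ht (edges_localPart_subset I π)
    (fun e s s' => eq_of_mem_edges_localPart I π) (known_subset stat ω I π) s
  have h3 : 0 ≤ t * (t * W) := by positivity
  have h4 : 0 ≤ ((1 + k ^ 2) * (2 * (k + 1)) ^ k + 1) * ((k + 1) * (k ^ 2 * (t * (t * W)))) := by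
    positivity
  have h5 : edgeFactor k * (t * (t * W)) = 2 * (t * (t * W)) +
      ((1 + k ^ 2) * (2 * (k + 1)) ^ k + 1) * ((k + 1) * (k ^ 2 * (t * (t * W)))) := by
    unfold edgeFactor
    ring
  rw [h5]
  split_ifs
  · exact h1.trans (by linarith)
  · exact h2.trans (by linarith)
  · simp only [Nat.cast_zero]
    positivity

end CliqueMPC


/-! ### The probability of a large load, and the theorem -/

namespace CliqueMPC

open Finset

variable {k n p m : ℕ}

theorem prob_maxLoad_le [NeZero p] (hk : 3 ≤ k) (hm : (p : ℝ) ^ (2 / k : ℝ) ≤ m)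
    {I : (ConjQuery.clique k).Instance n} (hI : ∀ e, (I e).card = m)
    (π : (ConjQuery.clique k).Placement n p) (c : ℕ) :
    1 - 1 / (p : ℝ) ^ c ≤ (cliqueAlgorithm k n p m ⌈(p : ℝ) ^ (1 / k : ℝ)⌉₊).prob (fun ω =>
      ((cliqueAlgorithm k n p m ⌈(p : ℝ) ^ (1 / k : ℝ)⌉₊).maxLoad
        ((ConjQuery.clique k).heavyHitters p I) ω ((ConjQuery.clique k).localPart I π) (k - 1) : ℝ) ≤
      edgeFactor k * (18 * k ^ 4 + 35 * k ^ 2 + c + 3) ^ 2 * (k + 2) * (1 + Real.log p) ^ 2 *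
        (binaryRelationBits m n / (p : ℝ) ^ (2 / k : ℝ))) := by
  have hp : 1 ≤ p := NeZero.pos p
  have hp' : (1 : ℝ) ≤ p := by exact_mod_cast hp
  have hk' : (3 : ℝ) ≤ k := by exact_mod_cast hk
  -- For `p = 1` the claimed probability is `0`. For `p ≥ 2`, `m > 1` forces `n ≥ 2`, so that `M` is
  -- not zero.
  rcases hp.eq_or_lt with rfl | hp2
  · simp only [Nat.cast_one, one_pow, div_one, sub_self]
    unfold MPCAlgorithm.prob
    positivity
  have hreg := regular_layout hk hp hm hI
  set Λ := ⌈(p : ℝ) ^ (1 / k : ℝ)⌉₊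
  set W := m / (p : ℝ) ^ (2 / k : ℝ) with hW
  have hW1 := hreg.one_le_bound
  have hm1 : 1 < m := by
    have h1 : (1 : ℝ) < (p : ℝ) ^ (2 / k : ℝ) :=
      Real.one_lt_rpow (by exact_mod_cast hp2) (by positivity)
    exact_mod_cast h1.trans_le hm
  have hn : 2 ≤ n := by
    by_contra hn
    have : Subsingleton (Fin n) := Fin.subsingleton_iff_le_one.2 (by omega)
    let e : (ConjQuery.clique k).Atom := ⟨(⟨0, by omega⟩, ⟨1, by omega⟩), by simp [Fin.lt_def]⟩
    have : (I e).card ≤ 1 := card_le_one.2 fun a _ b _ => funext fun i => Subsingleton.elim _ _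
    rw [hI] at this
    omega
  have hlog : 0 ≤ Real.log p := Real.log_nonneg hp'
  have hK0 : (0 : ℝ) < 35 * k ^ 2 := by positivity
  have hlogK : 0 ≤ Real.log (35 * k ^ 2) := Real.log_nonneg (by nlinarith)
  -- Chosen so that the failure bound of `Regular.pr_not_good` is exactly `1 / p ^ c`.
  set t : ℝ := 18 * k ^ 4 + Real.log (35 * k ^ 2) + (c + 3) * Real.log p with ht
  have hk4 : (1 : ℝ) ≤ k ^ 4 := one_le_pow₀ (by linarith)
  have ht1 : 1 ≤ t := by
    have : 0 ≤ (c + 3 : ℝ) * Real.log p := by positivity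
    linarith
  have htle : t ≤ (18 * k ^ 4 + 35 * k ^ 2 + c + 3) * (1 + Real.log p) := by
    have h1 : Real.log (35 * k ^ 2) ≤ 35 * k ^ 2 :=
      (Real.log_le_sub_one_of_pos hK0).trans (by linarith)
    have h2 : 0 ≤ (18 * (k : ℝ) ^ 4 + 35 * k ^ 2) * Real.log p := by positivity
    have h3 : (0 : ℝ) ≤ c := Nat.cast_nonneg c
    rw [ht]
    linarith
  have hbad : 35 * k ^ 2 * (p : ℝ) ^ 3 * Real.exp (18 * k ^ 4 - t) = 1 / (p : ℝ) ^ c := by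
    have h1 : (18 * k ^ 4 - t : ℝ) = -Real.log (35 * k ^ 2) + -(((c + 3 : ℕ) : ℝ) * Real.log p) := by
      rw [ht]
      push_cast
      ring
    have hp0 : (p : ℝ) ≠ 0 := by linarith
    rw [h1, Real.exp_add, Real.exp_neg, Real.exp_neg, Real.exp_log hK0, Real.exp_nat_mul,
      Real.exp_log (by linarith)]
    field_simp
    ring
  let instSeed : Fintype (cliqueAlgorithm k n p m Λ).Seed :=
    inferInstanceAs (Fintype ((Fin k → Fin n → Fin (Λ ^ 2 + 1)) ×
      (Vertex k n × Vertex k n × Fin k × Fin (Λ ^ 2 + 1) → Fin p)))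
  have := (cliqueAlgorithm k n p m Λ).nonemptySeed
  rw [prob_eq_pr]
  have hnot := hreg.pr_not_good (by omega) ht1
  rw [hbad] at hnot
  have hsplit := pr_not (Ω := (cliqueAlgorithm k n p m Λ).Seed)
    (Good (edges I) (layout Λ m ((ConjQuery.clique k).heavyHitters p I)) W t)
  have hgood : 1 - 1 / (p : ℝ) ^ c ≤ pr (Ω := (cliqueAlgorithm k n p m Λ).Seed)
      (Good (edges I) (layout Λ m ((ConjQuery.clique k).heavyHitters p I)) W t) := by
    have : pr (Ω := (cliqueAlgorithm k n p m Λ).Seed) (fun ω =>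
      ¬ Good (edges I) (layout Λ m ((ConjQuery.clique k).heavyHitters p I)) W t ω) ≤
        1 / (p : ℝ) ^ c := hnot
    linarith
  refine hgood.trans (pr_mono fun ω hω => ?_)
  refine (maxLoad_cliqueAlgorithm_le hk ht1 hreg π ω hω).trans ?_
  have hF : 0 ≤ edgeFactor k := by unfold edgeFactor; positivity
  have hbits := edge_bits_le (k := k) (by omega) hn
  calc _ ≤ edgeFactor k * (((18 * k ^ 4 + 35 * k ^ 2 + c + 3) * (1 + Real.log p)) *
        (((18 * k ^ 4 + 35 * k ^ 2 + c + 3) * (1 + Real.log p)) * W)) *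
        ((2 * k + 4) * Real.logb 2 n) := by gcongr
    _ = _ := by
      rw [hW, binaryRelationBits]
      ring

end CliqueMPC

open CliqueMPC in
theorem mainTheorem8 (k : ℕ) (hk : 3 ≤ k) :
    ∃ A : (p n m : ℕ) → (ConjQuery.clique k).Algorithm n p,
      -- the algorithm computes the query in `k - 1` rounds, for every choice of the seed
      (∀ p n m : ℕ, 1 ≤ p →
        ∀ I : (ConjQuery.clique k).Instance n, (∀ j, (I j).card = m) →
        ∀ π : (ConjQuery.clique k).Placement n p, (ConjQuery.clique k).IsUniform I π →
        ∀ ω : (A p n m).Seed,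
          (A p n m).result ((ConjQuery.clique k).heavyHitters p I) ω
              ((ConjQuery.clique k).localPart I π) (k - 1) =
            (ConjQuery.clique k).answer I) ∧
      -- with high probability, its load is `M / p ^ (2 / k)` up to a polylogarithmic factor in `p`
      ∃ d : ℕ, ∀ c : ℕ, ∃ C : ℝ, ∀ p n m : ℕ, 1 ≤ p → (p : ℝ) ^ (2 / k : ℝ) ≤ m →
        ∀ I : (ConjQuery.clique k).Instance n, (∀ j, (I j).card = m) →
        ∀ π : (ConjQuery.clique k).Placement n p, (ConjQuery.clique k).IsUniform I π →
          1 - 1 / (p : ℝ) ^ c ≤ (A p n m).prob (fun ω =>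
            ((A p n m).maxLoad ((ConjQuery.clique k).heavyHitters p I) ω
                ((ConjQuery.clique k).localPart I π) (k - 1) : ℝ) ≤
              C * (1 + Real.log p) ^ d * (binaryRelationBits m n / (p : ℝ) ^ (2 / k : ℝ))) := by
  have key : ∀ p n m : ℕ, ∃ A : (ConjQuery.clique k).Algorithm n p, 1 ≤ p →
      ∃ _ : NeZero p, A = cliqueAlgorithm k n p m ⌈(p : ℝ) ^ (1 / k : ℝ)⌉₊ := by
    intro p n m
    rcases Nat.eq_zero_or_pos p with rfl | hp
    -- A dummy algorithm for `p = 0`, about which nothing is claimed.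
    · exact ⟨⟨Unit, fun _ _ _ _ _ _ => [], fun _ _ _ _ _ => ∅⟩, fun h => absurd h (by norm_num)⟩
    · exact ⟨@cliqueAlgorithm k n p m ⌈(p : ℝ) ^ (1 / k : ℝ)⌉₊ ⟨hp.ne'⟩, fun _ => ⟨⟨hp.ne'⟩, rfl⟩⟩
  choose A hA using key
  refine ⟨A, fun p n m hp I hI π _ => ?_, 2, fun c =>
    ⟨edgeFactor k * (18 * k ^ 4 + 35 * k ^ 2 + c + 3) ^ 2 * (k + 2),
      fun p n m hp hm I hI π _ => ?_⟩⟩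
  · obtain ⟨_, hA⟩ := hA p n m hp
    rw [hA]
    intro ω
    refine result_cliqueAlgorithm hk (Nat.ceil_pos.2 ?_) _ ω I π
    exact Real.rpow_pos_of_pos (by exact_mod_cast hp) _
  · obtain ⟨_, hA⟩ := hA p n m hp
    rw [hA]
    exact prob_maxLoad_le hk hm hI π c
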